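/- Let $K$ be a field of characteristic $\neq 2,3$, let $j\in K$ with $j\neq 0,1728$, and set $A=\frac{3^3 j}{2^2(j-1728)}$. Then $E: y^2=x^3-Ax+A$ is an elliptic curve over $K$ with $j$-invariant $j$. The polynomial $f(x)=A(x+1)^4(x^2+1)^4-2^6x^3(x^2+x+1)^3$ is separable, and the hyperelliptic curve $H$ over $K$ (smooth and complete) with equation $y^2=f(x)$ has genus $5$ and has two independent maps to $E$ defined over $K$. These maps can be described as follows. Put $B=A/2^6$ and let $D$ be the smooth complete curve with equation $y^2=x^4+x^3+B$. The affine space curve given by $$y^2=x^4+x^3+B,\qquad (x^3+x^2z+xz^2+z^3)+(x^2+xz+z^2)=0$$ is integral, and $H$ is isomorphic over $K$ to the desingularization of its projective closure. Hence $(x,y,z)\mapsto (x,y)$ and $(x,y,z)\mapsto (z,y)$ define morphisms $f_1,f_2:H\to D$. There is an isomorphism $\psi: D\to E$ of curves over $K$, and the two maps are $g_1=\psi\circ f_1$ and $g_2=\psi\circ f_2$. Here independent means linearly independent over $\mathrm{End}_K(E)$ modulo constant maps: if $\alpha,\beta:E\to E$ are morphisms of curves over $K$ such that $\alpha\circ g_1+\beta\circ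 g_2$ (sum in the group law of $E$) is constant, then $\alpha$ and $\beta$ are constant. -/

import Mathlib

open Polynomial

/-! ### Curves through their function fields

A regular complete curve over a field `K` is represented by its function field `F`: its closed points
are the places of `F`, and the local ring at a closed point is the corresponding valuation ring. -/

/-- A closed point of the regular complete curve over `K` with function field `F`: a valuation
subring of `F`, different from `F`, that contains the constants `K`. -/
structure Place (K F : Type*) [Field K] [Field F] [Algebra K F] where
  /-- the local ring at the point -/
  ring : ValuationSubring F
  algebraMap_mem : ∀ c : K, algebraMap K F c ∈ ring
  ne_top : ring ≠ ⊤

/-- A nonconstant morphism over `K` from the regular complete curve with function field `F` to the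
regular complete curve with function field `G`: a map on closed points together with a pullback of
rational functions, such that a rational function `g` on the target is regular at the image of a
point `P` exactly when its pullback is regular at `P`. -/
structure CurveMap (K F G : Type*) [Field K] [Field F] [Algebra K F] [Field G] [Algebra K G] where
  /-- the pullback of rational functions -/
  pullback : G →ₐ[K] F
  /-- the map on closed points -/
  onPlaces : Place K F → Place K G
  mem_iff : ∀ (P : Place K F) (g : G), g ∈ (onPlaces P).ring ↔ pullback g ∈ P.ring

/-- The composition `ψ ∘ f`. -/
def CurveMap.comp {K F G L : Type*} [Field K] [Field F] [Algebra K F] [Field G] [Algebra K G]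
    [Field L] [Algebra K L] (ψ : CurveMap K G L) (f : CurveMap K F G) : CurveMap K F L where
  pullback := f.pullback.comp ψ.pullback
  onPlaces := fun P => ψ.onPlaces (f.onPlaces P)
  mem_iff := fun P g => (ψ.mem_iff (f.onPlaces P) g).trans (f.mem_iff P (ψ.pullback g))

/-- The morphism is an isomorphism of curves. -/
def CurveMap.IsIso {K F G : Type*} [Field K] [Field F] [Algebra K F] [Field G] [Algebra K G]
    (f : CurveMap K F G) : Prop :=
  Function.Bijective f.pullback ∧ Function.Bijective f.onPlaces

/-- The rational differentials that are regular at the point `P`: the image of the Kähler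
differentials of the local ring at `P`, that is, all sums of `a • db` with `a`, `b` regular at `P`. -/
noncomputable def regularDifferentialsAt (K F : Type*) [Field K] [Field F] [Algebra K F]
    (P : Place K F) : Submodule K (Ω[F⁄K]) :=
  Submodule.span K {ω | ∃ a ∈ P.ring, ∃ b ∈ P.ring, ω = a • KaehlerDifferential.D K F b}

/-- The genus of the curve with function field `F` (used for smooth curves): the dimension over `K`
of the space of everywhere regular differentials. -/
noncomputable def curveGenus (K F : Type*) [Field K] [Field F] [Algebra K F] : ℕ :=
  Module.finrank K (⨅ P : Place K F, regularDifferentialsAt K F P : Submodule K (Ω[F⁄K]))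

/-! ### The curves `y² = f(x)` -/

/-- An equation `y² = f(x)` with `f` a nonconstant separable polynomial. In characteristic other
than `2` this affine curve is smooth and geometrically integral; its smooth complete model is called
a hyperelliptic curve when its genus is at least `2`. -/
structure QuadraticCover (K : Type*) [Field K] where
  f : K[X]
  separable : f.Separable
  natDegree_pos : 0 < f.natDegree

namespace QuadraticCover

variable {K : Type*} [Field K] (H : QuadraticCover K)

/-- The coordinate ring `K[x][y] / (y² - f(x))`. -/
abbrev CoordinateRing : Type _ := AdjoinRoot (X ^ 2 - C H.f : K[X][X])

theorem prime_polynomial : Prime (X ^ 2 - C H.f : K[X][X]) := by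
  rw [← UniqueFactorizationMonoid.irreducible_iff_prime]
  have hm : (X ^ 2 - C H.f : K[X][X]).Monic := monic_X_pow_sub_C _ two_ne_zero
  have hd : (X ^ 2 - C H.f : K[X][X]).natDegree = 2 := natDegree_X_pow_sub_C
  by_contra hirr
  rw [hm.not_irreducible_iff_exists_add_mul_eq_coeff hd] at hirr
  obtain ⟨c₁, c₂, h0, h1⟩ := hirr
  simp at h0 h1
  have hc : c₂ = -c₁ := by linear_combination -h1
  have hf : H.f = c₁ * c₁ := by rw [hc] at h0; linear_combination -h0
  have hu : IsUnit c₁ := H.separable.squarefree c₁ (hf ▸ dvd_rfl)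
  have hu' : IsUnit H.f := hf ▸ hu.mul hu
  have := natDegree_eq_zero_of_isUnit hu'
  have := H.natDegree_pos
  omega

instance : IsDomain H.CoordinateRing := AdjoinRoot.isDomain_of_prime H.prime_polynomial

/-- The function field of the curve. -/
abbrev FunctionField : Type _ := FractionRing H.CoordinateRing

/-- The coordinate function `x`. -/
noncomputable def x : H.FunctionField :=
  algebraMap H.CoordinateRing H.FunctionField (AdjoinRoot.of _ X)

/-- The coordinate function `y`. -/
noncomputable def y : H.FunctionField :=
  algebraMap H.CoordinateRing H.FunctionField (AdjoinRoot.root _)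

end QuadraticCover

/-! ### The affine space curve `y² = x⁴ + x³ + B`, `(x⁴ - z⁴)/(x - z) + (x³ - z³)/(x - z) = 0` -/

/-- The ideal of the space curve; the variables `0, 1, 2` are `x, y, z`. -/
noncomputable def spaceCurveIdeal {K : Type*} [Field K] (B : K) : Ideal (MvPolynomial (Fin 3) K) :=
  Ideal.span
    {MvPolynomial.X 1 ^ 2 - (MvPolynomial.X 0 ^ 4 + MvPolynomial.X 0 ^ 3 + MvPolynomial.C B),
      (MvPolynomial.X 0 ^ 3 + MvPolynomial.X 0 ^ 2 * MvPolynomial.X 2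
          + MvPolynomial.X 0 * MvPolynomial.X 2 ^ 2 + MvPolynomial.X 2 ^ 3)
        + (MvPolynomial.X 0 ^ 2 + MvPolynomial.X 0 * MvPolynomial.X 2 + MvPolynomial.X 2 ^ 2)}

/-- The coordinate ring of the space curve. -/
abbrev SpaceCurveRing {K : Type*} [Field K] (B : K) : Type _ :=
  MvPolynomial (Fin 3) K ⧸ spaceCurveIdeal B

/-- The coordinate functions `x, y, z` on the space curve, for `i = 0, 1, 2`. -/
noncomputable def spaceCurveCoord {K : Type*} [Field K] (B : K) (i : Fin 3) : SpaceCurveRing B :=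
  Ideal.Quotient.mk (spaceCurveIdeal B) (MvPolynomial.X i)

/-- The homomorphism `ι` identifies the field `F` with the field of fractions of `R`. For `R` the
coordinate ring of an affine curve this says that the curve is integral and that the curve with
function field `F` is the desingularization of its projective closure. -/
def IsFunctionFieldEmbedding {K R F : Type*} [Field K] [CommRing R] [Algebra K R] [Field F]
    [Algebra K F] (ι : R →ₐ[K] F) : Prop :=
  Function.Injective ι ∧ ∀ h : F, ∃ a b : R, ι b ≠ 0 ∧ h = ι a / ι b

/-! ### Independence of maps to an elliptic curve -/

open scoped Classical in
/-- Independence of two nonconstant morphisms `g₁`, `g₂` over `K` to an elliptic curve `E` from the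
regular complete curve `X` with function field `F`.

The group of all morphisms `X → E` over `K`, constant or not, is `E(F)`, the constant morphisms being
the points of `E(K)`; likewise the morphisms `E → E` (the endomorphisms of `E` as a curve of genus
one: sums of an endomorphism of the elliptic curve and a constant) are the points of `E(K(E))`, and
composition with `gᵢ` is the map `E(K(E)) → E(F)` induced by the pullback. So the condition says: if
`α ∘ g₁ + β ∘ g₂` is constant then `α` and `β` are constant. This is linear independence over the
ring `End(E)` of the classes of `g₁` and `g₂` in the group of morphisms `X → E` modulo constants. -/
def IndependentMaps {K F : Type*} [Field K] [Field F] [Algebra K F] (E : WeierstrassCurve.Affine K)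
    (g₁ g₂ : CurveMap K F E.FunctionField) : Prop :=
  ∀ α β : (E.baseChange E.FunctionField).Point,
    (∃ c : (E.baseChange K).Point,
      WeierstrassCurve.Affine.Point.map (W' := E) g₁.pullback α
        + WeierstrassCurve.Affine.Point.map (W' := E) g₂.pullback β
        = WeierstrassCurve.Affine.Point.map (W' := E) (Algebra.ofId K F) c) →
    (∃ a : (E.baseChange K).Point,
      α = WeierstrassCurve.Affine.Point.map (W' := E) (Algebra.ofId K E.FunctionField) a) ∧
    (∃ b : (E.baseChange K).Point,
      β = WeierstrassCurve.Affine.Point.map (W' := E) (Algebra.ofId K E.FunctionField) b)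

/-! The plane cubic in x and z is singular at the origin, so a line z = t x meets it in one further
point, with x = -(1 + t + t²) / u and u = (1 + t)(1 + t²). Since x + 1 = t³ / u, the equation y² =
x⁴ + x³ + A / 2⁶ turns into (8 u² y)² = A u⁴ - 2⁶ (t (1 + t + t²))³, which is the equation of H with
t as its first coordinate. The cubic is the divided difference of T⁴ + T³ at x and z, so H
parametrizes ordered pairs of points of D in one fibre of y, and f₁, f₂ pick the two members of the
pair. Integrality of the space curve comes from the irreducibility of the cubic
(`planeCubic_irreducible`) and the involution y ↦ -y.

Independence: suppose that α ∘ g₁ + β ∘ g₂ is constant. If P and P' are generic points of D with the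
same y, there is a point Q in the same fibre such that (P, Q) and (P', Q) both lie on H. Subtracting
the relation at these two points cancels β, so α ∘ ψ agrees at P and P' (`map_eq_map_of_add_const`).
Hence the coordinates of α ∘ ψ are functions of y alone (`QuadraticCover.mem_adjoin_y`), so α ∘ ψ
factors through a line. A point of E over a rational function field is constant
(`mem_range_of_rational`), by descent on pencils of polynomials with four square members
(`natDegree_eq_zero_of_four_squares`). Then β ∘ g₂ is constant as well, hence so is β. Geometric
generic points appear as embeddings of function fields into an algebraically closed field.

Genus: dx / y generates the regular differentials wherever x is regular, and the automorphism (x, y)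
↦ (1 / x, y / x⁶) carries this to the places where 1 / x is regular
(`QuadraticCover.mem_regularDifferentialsAt_iff`). The regular differentials are then the p(x) dx /
y with deg p ≤ 4. -/

theorem AdjoinRoot.mk_modByMonic {R : Type*} [CommRing R] (g p : R[X]) :
    AdjoinRoot.mk g (p %ₘ g) = AdjoinRoot.mk g p := by
  conv_rhs => rw [← modByMonic_add_div p g]
  rw [map_add, map_mul, AdjoinRoot.mk_self, zero_mul, add_zero]

theorem IntermediateField.algHom_ext_of_adjoin_eq_top {K F L : Type*} [Field K] [Field F]
    [Algebra K F] [Field L] [Algebra K L] {S : Set F} (hS : adjoin K S = ⊤) {φ ψ : F →ₐ[K] L}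
    (h : Set.EqOn φ ψ S) : φ = ψ := by
  ext a
  have ha : a ∈ adjoin K S := hS ▸ mem_top
  induction ha using adjoin_induction with
  | mem x hx => exact h hx
  | algebraMap c => simp
  | add x y _ _ hx hy => rw [map_add, map_add, hx, hy]
  | inv x _ hx => rw [map_inv₀, map_inv₀, hx]
  | mul x y _ _ hx hy => rw [map_mul, map_mul, hx, hy]

/-! ### Function fields of the curves y² = f(x): normal forms and embeddings -/

namespace QuadraticCover

variable {K : Type*} [Field K] (H : QuadraticCover K)

theorem y_sq : H.y ^ 2 = aeval H.x H.f := by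
  have h : (AdjoinRoot.root (X ^ 2 - C H.f : K[X][X])) ^ 2 = AdjoinRoot.of _ H.f := by
    have := AdjoinRoot.eval₂_root (X ^ 2 - C H.f : K[X][X])
    simpa [sub_eq_zero] using this
  have h2 : ∀ p : K[X], aeval H.x p
      = algebraMap H.CoordinateRing H.FunctionField (AdjoinRoot.of _ p) := by
    intro p
    induction p using Polynomial.induction_on' with
    | add p q hp hq => simp [hp, hq]
    | monomial n a =>
      rw [aeval_monomial, ← C_mul_X_pow_eq_monomial, map_mul, map_mul, map_pow, map_pow]
      rfl
  rw [h2, ← h, map_pow]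
  rfl

theorem algebraMap_of (p : K[X]) :
    algebraMap H.CoordinateRing H.FunctionField (AdjoinRoot.of _ p) = aeval H.x p := by
  induction p using Polynomial.induction_on' with
  | add p q hp hq => simp [hp, hq]
  | monomial n a =>
    rw [aeval_monomial, ← C_mul_X_pow_eq_monomial, map_mul, map_mul, map_pow, map_pow]
    rfl

theorem algebraMap_polynomial (p : K[X]) : algebraMap K[X] H.FunctionField p = aeval H.x p := by
  rw [← algebraMap_of]; rfl

theorem exists_coordinateRing (r : H.CoordinateRing) :
    ∃ p q : K[X], algebraMap H.CoordinateRing H.FunctionField r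
      = aeval H.x p + aeval H.x q * H.y := by
  induction r using AdjoinRoot.induction_on with
  | ih g =>
  have hm : (X ^ 2 - C H.f : K[X][X]).Monic := monic_X_pow_sub_C _ two_ne_zero
  have hd : (X ^ 2 - C H.f : K[X][X]).natDegree = 2 := natDegree_X_pow_sub_C
  have h1 : (g %ₘ (X ^ 2 - C H.f)).natDegree < 2 := by
    refine (natDegree_modByMonic_lt _ hm fun h => ?_).trans_eq hd
    rw [h, natDegree_one] at hd
    exact absurd hd (by norm_num)
  refine ⟨(g %ₘ (X ^ 2 - C H.f)).coeff 0, (g %ₘ (X ^ 2 - C H.f)).coeff 1, ?_⟩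
  rw [← AdjoinRoot.mk_modByMonic]
  generalize g %ₘ (X ^ 2 - C H.f) = r at h1 ⊢
  conv_lhs => rw [eq_X_add_C_of_natDegree_le_one (Nat.lt_succ_iff.mp h1)]
  rw [map_add, map_mul, AdjoinRoot.mk_C, AdjoinRoot.mk_C, AdjoinRoot.mk_X, map_add, map_mul,
    algebraMap_of, algebraMap_of, add_comm]
  rfl

theorem transcendental_x : Transcendental K H.x := by
  rw [transcendental_iff_injective]
  intro p q h
  rw [← algebraMap_of, ← algebraMap_of] at h
  exact AdjoinRoot.of.injective_of_degree_ne_zero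
    (by rw [degree_X_pow_sub_C two_pos]; norm_num) (IsFractionRing.injective _ _ h)

variable {L : Type*} [Field L] [Algebra K L]

theorem aeval_injective {s : L} (hs : Transcendental K s) :
    Function.Injective (aeval s : K[X] →ₐ[K] L) := transcendental_iff_injective.mp hs

/-- A polynomial identity `p² = f q²` forces `p = q = 0`. -/
theorem eq_zero_of_sq_eq {p q : K[X]} (h : p ^ 2 = H.f * q ^ 2) : p = 0 ∧ q = 0 := by
  have hq : q = 0 := by
    by_contra hq
    have h1 : q ∣ p := by
      rw [← IsIntegrallyClosed.pow_dvd_pow_iff two_ne_zero, h]; exact dvd_mul_left _ _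
    obtain ⟨c, rfl⟩ := h1
    have h2 : H.f = c * c := by
      have : q ^ 2 * (c * c) = q ^ 2 * H.f := by linear_combination h
      exact (mul_left_cancel₀ (pow_ne_zero 2 hq) this).symm
    have hu : IsUnit c := H.separable.squarefree c (h2 ▸ dvd_rfl)
    have hu' : IsUnit H.f := h2 ▸ hu.mul hu
    have := natDegree_eq_zero_of_isUnit hu'
    have := H.natDegree_pos
    omega
  subst hq
  simpa using h

theorem eq_zero_of_add_mul_eq_zero {s w : L} (hs : Transcendental K s) (hw : w ^ 2 = aeval s H.f)
    {p q : K[X]} (h : aeval s p + aeval s q * w = 0) : p = 0 ∧ q = 0 := by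
  apply H.eq_zero_of_sq_eq
  apply aeval_injective hs
  rw [map_pow, map_mul, map_pow]
  -- Multiplication by the conjugate p(s) - q(s) w yields p² = f q².
  linear_combination (aeval s p - aeval s q * w) * h + (aeval s q) ^ 2 * hw

/-- The restriction of `lift` to the coordinate ring. -/
noncomputable def ringLift {s w : L} (hw : w ^ 2 = aeval s H.f) : H.CoordinateRing →+* L :=
  AdjoinRoot.lift (aeval s : K[X] →ₐ[K] L).toRingHom w (by simp [hw])

theorem ringLift_injective {s w : L} (hs : Transcendental K s) (hw : w ^ 2 = aeval s H.f) :
    Function.Injective (H.ringLift hw) := by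
  rw [injective_iff_map_eq_zero]
  intro r hr
  obtain ⟨p, q, h⟩ := H.exists_coordinateRing r
  have h2 : r = AdjoinRoot.of _ p + AdjoinRoot.of _ q * AdjoinRoot.root _ := by
    apply IsFractionRing.injective H.CoordinateRing H.FunctionField
    rw [h, map_add, map_mul, algebraMap_of, algebraMap_of]; rfl
  rw [h2] at hr ⊢
  simp only [ringLift, map_add, map_mul, AdjoinRoot.lift_of, AdjoinRoot.lift_root] at hr
  obtain ⟨rfl, rfl⟩ := H.eq_zero_of_add_mul_eq_zero hs hw hr
  simp

/-- The embedding of the function field of `y² = f(x)` given by a point `(s, w)` with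
transcendental first coordinate. -/
noncomputable def lift {s w : L} (hs : Transcendental K s) (hw : w ^ 2 = aeval s H.f) :
    H.FunctionField →ₐ[K] L where
  __ := IsFractionRing.lift (H.ringLift_injective hs hw)
  commutes' c := by
    have h1 : algebraMap K H.FunctionField c
        = algebraMap H.CoordinateRing H.FunctionField (AdjoinRoot.of _ (C c)) := by
      rw [algebraMap_of, aeval_C]
    change IsFractionRing.lift (H.ringLift_injective hs hw) (algebraMap K H.FunctionField c) = _
    rw [h1, IsFractionRing.lift_algebraMap]
    simp [ringLift]

@[simp] theorem lift_x {s w : L} (hs : Transcendental K s) (hw : w ^ 2 = aeval s H.f) :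
    H.lift hs hw H.x = s := by
  change IsFractionRing.lift (H.ringLift_injective hs hw) _ = _
  rw [x, IsFractionRing.lift_algebraMap]
  simp [ringLift]

@[simp] theorem lift_y {s w : L} (hs : Transcendental K s) (hw : w ^ 2 = aeval s H.f) :
    H.lift hs hw H.y = w := by
  change IsFractionRing.lift (H.ringLift_injective hs hw) _ = _
  rw [y, IsFractionRing.lift_algebraMap]
  simp [ringLift]

theorem adjoin_eq_top : IntermediateField.adjoin K {H.x, H.y} = ⊤ := by
  rw [eq_top_iff]
  intro h _
  have hx : H.x ∈ IntermediateField.adjoin K {H.x, H.y} :=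
    IntermediateField.subset_adjoin _ _ (by simp)
  have hy : H.y ∈ IntermediateField.adjoin K {H.x, H.y} :=
    IntermediateField.subset_adjoin _ _ (by simp)
  have hp : ∀ p : K[X], aeval H.x p ∈ IntermediateField.adjoin K {H.x, H.y} := fun p =>
    Algebra.adjoin_le (S := (IntermediateField.adjoin K {H.x, H.y}).toSubalgebra)
      (by simpa using hx) (aeval_mem_adjoin_singleton K H.x)
  obtain ⟨a, b, -, rfl⟩ := IsFractionRing.div_surjective (A := H.CoordinateRing) h
  obtain ⟨p, q, h1⟩ := H.exists_coordinateRing a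
  obtain ⟨p', q', h2⟩ := H.exists_coordinateRing b
  rw [h1, h2]
  exact div_mem (add_mem (hp _) (mul_mem (hp _) hy)) (add_mem (hp _) (mul_mem (hp _) hy))

theorem algHom_ext {φ ψ : H.FunctionField →ₐ[K] L} (hx : φ H.x = ψ H.x) (hy : φ H.y = ψ H.y) :
    φ = ψ := by
  apply IntermediateField.algHom_ext_of_adjoin_eq_top H.adjoin_eq_top
  rintro a (rfl | rfl)
  · exact hx
  · exact hy

/-- Every element of the function field is `(p(x) + q(x) y) / n(x)`. -/
theorem exists_eq_div (h : H.FunctionField) : ∃ p q n : K[X], n ≠ 0 ∧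
    h = (aeval H.x p + aeval H.x q * H.y) / aeval H.x n := by
  obtain ⟨a, b, hb, rfl⟩ := IsFractionRing.div_surjective (A := H.CoordinateRing) h
  obtain ⟨p, q, h1⟩ := H.exists_coordinateRing a
  obtain ⟨r, s, h2⟩ := H.exists_coordinateRing b
  have hb0 : algebraMap H.CoordinateRing H.FunctionField b ≠ 0 :=
    IsFractionRing.to_map_ne_zero_of_mem_nonZeroDivisors hb
  rw [h1, h2]
  rw [h2] at hb0
  have hn : r ^ 2 - H.f * s ^ 2 ≠ 0 := by
    intro h0
    obtain ⟨rfl, rfl⟩ := H.eq_zero_of_sq_eq (sub_eq_zero.mp h0)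
    simp at hb0
  -- Numerator and denominator are multiplied by r - s y, the conjugate of the denominator.
  refine ⟨p * r - q * s * H.f, q * r - p * s, r ^ 2 - H.f * s ^ 2, hn, ?_⟩
  have hn' : aeval H.x (r ^ 2 - H.f * s ^ 2) ≠ 0 := by
    rw [Ne, map_eq_zero_iff _ (aeval_injective H.transcendental_x)]; exact hn
  rw [div_eq_div_iff hb0 hn']
  simp only [map_sub, map_mul, map_pow]
  linear_combination (aeval H.x p * (aeval H.x s) ^ 2
    - aeval H.x q * aeval H.x s * aeval H.x r) * H.y_sq

end QuadraticCover

/-! ### Nonconstant morphisms from embeddings of function fields -/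

section CurveMap

variable {K F G : Type*} [Field K] [Field F] [Algebra K F] [Field G] [Algebra K G]

/-- The morphism of curves given by an embedding of function fields over which the larger
function field is algebraic. -/
noncomputable def CurveMap.ofAlgHom (φ : G →ₐ[K] F) (hφ : Algebra.IsAlgebraic φ.fieldRange F) :
    CurveMap K F G where
  pullback := φ
  onPlaces P :=
    { ring := P.ring.comap φ.toRingHom
      algebraMap_mem := fun c => by
        change φ (algebraMap K G c) ∈ P.ring
        rw [AlgHom.commutes]
        exact P.algebraMap_mem c
      ne_top := fun htop => P.ne_top <| by
        rw [eq_top_iff]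
        intro a _
        -- The valuation ring at P would contain φ(G), over which F is algebraic; being integrally
        -- closed, it would be all of F.
        have hle : φ.fieldRange.toSubring ≤ P.ring.toSubring := by
          rintro _ ⟨g, rfl⟩
          have : g ∈ P.ring.comap φ.toRingHom := htop ▸ ValuationSubring.mem_top g
          exact this
        have ha : IsIntegral φ.fieldRange a := (hφ.isAlgebraic a).isIntegral
        let j : φ.fieldRange →+* P.ring := Subring.inclusion hle
        have ha' : IsIntegral P.ring a := by
          obtain ⟨p, hp, hpa⟩ := ha
          refine ⟨p.map j, hp.map j, ?_⟩
          rw [eval₂_map]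
          exact hpa
        obtain ⟨b, rfl⟩ := IsIntegrallyClosed.isIntegral_iff.mp ha'
        exact b.2 }
  mem_iff _ _ := Iff.rfl

/-- The image of a closed point under an isomorphism of function fields. -/
def Place.comapEquiv (e : G ≃ₐ[K] F) (P : Place K F) : Place K G where
  ring := P.ring.comap e.toAlgHom.toRingHom
  algebraMap_mem c := by
    change e (algebraMap K G c) ∈ P.ring
    rw [AlgEquiv.commutes]
    exact P.algebraMap_mem c
  ne_top htop := P.ne_top <| by
    rw [eq_top_iff]
    intro a _
    have : e.symm a ∈ P.ring.comap e.toAlgHom.toRingHom := htop ▸ ValuationSubring.mem_top _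
    change e (e.symm a) ∈ P.ring at this
    rwa [e.apply_symm_apply] at this

theorem Place.mem_comapEquiv (e : G ≃ₐ[K] F) (P : Place K F) (g : G) :
    g ∈ (P.comapEquiv e).ring ↔ e g ∈ P.ring := Iff.rfl

theorem Place.ext_ring {P Q : Place K F} (h : P.ring = Q.ring) : P = Q := by
  cases P; cases Q; cases h; rfl

theorem CurveMap.ofAlgHom_isIso (φ : G →ₐ[K] F) (hφ : Algebra.IsAlgebraic φ.fieldRange F)
    (hb : Function.Bijective φ) : (CurveMap.ofAlgHom φ hφ).IsIso := by
  refine ⟨hb, fun P Q h => ?_, fun P => ?_⟩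
  · apply Place.ext_ring
    ext a
    obtain ⟨g, rfl⟩ := hb.2 a
    rw [← show _ ↔ φ g ∈ P.ring from (CurveMap.ofAlgHom φ hφ).mem_iff P g, h]
    exact (CurveMap.ofAlgHom φ hφ).mem_iff Q g
  · let e := AlgEquiv.ofBijective φ hb
    refine ⟨P.comapEquiv e.symm, Place.ext_ring ?_⟩
    ext g
    rw [(CurveMap.ofAlgHom φ hφ).mem_iff, Place.mem_comapEquiv]
    change e.symm (e g) ∈ P.ring ↔ _
    rw [e.symm_apply_apply]

end CurveMap

/-! ### Algebraic elements -/

section Algebraic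

variable {K F : Type*} [Field K] [Field F] [Algebra K F]

/-- One nonzero end coefficient already makes the polynomial nonzero. The degree may drop, so a
leading coefficient such as z + 1 needs no separate treatment. -/
theorem IsAlgebraic.of_cubic (M : IntermediateField K F) {t a b c d : F} (ha : a ∈ M) (hb : b ∈ M)
    (hc : c ∈ M) (hd : d ∈ M) (h0 : a ≠ 0 ∨ d ≠ 0) (h : a * t ^ 3 + b * t ^ 2 + c * t + d = 0) :
    IsAlgebraic M t := by
  refine ⟨C ⟨a, ha⟩ * X ^ 3 + C ⟨b, hb⟩ * X ^ 2 + C ⟨c, hc⟩ * X + C ⟨d, hd⟩, fun hp => ?_, ?_⟩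
  · have h3 := congrArg (fun q => (coeff q 3 : M)) hp
    have hz := congrArg (fun q => (coeff q 0 : M)) hp
    simp [coeff_X, coeff_C, coeff_X_pow, -map_add, -map_mul] at h3 hz
    rw [Subtype.ext_iff] at h3 hz
    exact h0.elim (fun h => h h3) (fun h => h hz)
  · simpa [IntermediateField.algebraMap_apply] using h

theorem IsAlgebraic.of_quartic (M : IntermediateField K F) {t d : F} (hd : d ∈ M)
    (h : t ^ 4 + t ^ 3 + d = 0) : IsAlgebraic M t := by
  refine ⟨X ^ 4 + X ^ 3 + C ⟨d, hd⟩, fun hp => ?_, ?_⟩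
  · have h4 := congrArg (fun q => (coeff q 4 : M)) hp
    simp [coeff_X_pow] at h4
  · simpa [IntermediateField.algebraMap_apply] using h

theorem IsAlgebraic.of_algebraicClosure {t : F} (h : IsAlgebraic (algebraicClosure K F) t) :
    IsAlgebraic K t := h.restrictScalars K

theorem Transcendental.ne_algebraMap {t : F} (h : Transcendental K t) (c : K) :
    t ≠ algebraMap K F c := fun h' => h (h' ▸ isAlgebraic_algebraMap c)

theorem IsAlgebraic.of_adjoin_eq_top (M : IntermediateField K F) {S : Set F}
    (hS : IntermediateField.adjoin K S = ⊤) (h : ∀ s ∈ S, IsAlgebraic M s) :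
    Algebra.IsAlgebraic M F := by
  refine ⟨fun a => ?_⟩
  have ha : a ∈ IntermediateField.adjoin K S := hS ▸ IntermediateField.mem_top
  induction ha using IntermediateField.adjoin_induction with
  | mem x hx => exact h x hx
  | algebraMap c =>
    rw [IsScalarTower.algebraMap_apply K M F]
    exact isAlgebraic_algebraMap _
  | add x y _ _ hx hy => exact hx.add hy
  | inv x _ hx => exact hx.inv
  | mul x y _ _ hx hy => exact hx.mul hy

end Algebraic

/-! ### The parametrization of the plane cubic -/

section Parametrization

variable {F : Type*} [Field F]

/-- The first coordinate of the point with slope `t` of the nodal plane cubic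
`(x⁴ - z⁴)/(x - z) + (x³ - z³)/(x - z) = 0`. -/
def cubicX (t : F) : F := -(1 + t + t ^ 2) / ((1 + t) * (1 + t ^ 2))

/-- The two homogeneous parts of the plane cubic have no common zero. -/
theorem denom_ne_zero_of_mul_add_eq_zero {a t : F}
    (h : a * ((1 + t) * (1 + t ^ 2)) + (1 + t + t ^ 2) = 0) : (1 + t) * (1 + t ^ 2) ≠ 0 := by
  intro hu
  rw [hu, mul_zero, zero_add] at h
  have h3 : t ^ 3 = 0 := by linear_combination hu - h
  have ht : t = 0 := by simpa using h3
  subst ht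
  simp at h

theorem eq_cubicX {a t : F} (h : a * ((1 + t) * (1 + t ^ 2)) + (1 + t + t ^ 2) = 0) :
    a = cubicX t := by
  rw [cubicX, eq_div_iff (denom_ne_zero_of_mul_add_eq_zero h)]
  linear_combination h

theorem cubicX_mul {t : F} (hu : (1 + t) * (1 + t ^ 2) ≠ 0) :
    cubicX t * ((1 + t) * (1 + t ^ 2)) + (1 + t + t ^ 2) = 0 := by
  rw [cubicX, div_mul_cancel₀ _ hu]; ring

end Parametrization

/-! ### Separability of the quartic and of the polynomial of degree 12 -/

section Separable

variable {K : Type*} [Field K]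

theorem two_three_ne_zero (h2 : ringChar K ≠ 2) (h3 : ringChar K ≠ 3) :
    (2 : K) ≠ 0 ∧ (3 : K) ≠ 0 := by
  refine ⟨Ring.two_ne_zero h2, fun h => ?_⟩
  have : ringChar K ∣ 3 := (ringChar.spec K 3).mp (by exact_mod_cast h)
  rcases (Nat.dvd_prime Nat.prime_three).mp this with h1 | h1
  · have := ringChar.spec K 1
    rw [h1] at this
    simp at this
  · exact h3 h1

theorem separable_of_no_common_root {f : K[X]}
    (h : ∀ r : AlgebraicClosure K, aeval r f = 0 → aeval r (derivative f) ≠ 0) : f.Separable := by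
  rw [Separable, isCoprime_iff_aeval_ne_zero_of_isAlgClosed K (AlgebraicClosure K)]
  intro r
  by_contra! hr
  exact h r hr.1 hr.2

/-- The product is the derivative of the quartic. Where x = 0, x⁴ + x³ vanishes; where 4x + 3 = 0,
256 (x⁴ + x³) = -27. -/
theorem quartic_no_double_root {k : Type*} [Field k] {B x : k}
    (hB : B ≠ 0) (hB' : 256 * B ≠ 27) (h : x ^ 4 + x ^ 3 + B = 0) : x ^ 2 * (4 * x + 3) ≠ 0 := by
  intro h'
  rcases mul_eq_zero.mp h' with h0 | h0
  · have : x = 0 := by simpa using h0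
    subst this
    exact hB (by simpa using h)
  · apply hB'
    linear_combination 256 * h - (64 * x ^ 3 + 16 * x ^ 2 - 12 * x + 9) * h0

theorem separable_quartic {B : K} (hB : B ≠ 0)
    (hB' : 256 * B ≠ 27) : (X ^ 4 + X ^ 3 + C B : K[X]).Separable := by
  apply separable_of_no_common_root
  intro r hr hr'
  have inj := (algebraMap K (AlgebraicClosure K)).injective
  simp [map_ofNat] at hr hr'
  refine quartic_no_double_root (B := algebraMap K (AlgebraicClosure K) B) (x := r) ?_ ?_ hr ?_
  · simpa using inj.ne hB
  · simpa [map_ofNat] using inj.ne hB'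
  · linear_combination hr'

/-- The polynomial of degree `12` that defines the curve of genus `5`. -/
noncomputable def hyperellipticPoly (A : K) : K[X] :=
  C A * (X + 1) ^ 4 * (X ^ 2 + 1) ^ 4 - 2 ^ 6 * X ^ 3 * (X ^ 2 + X + 1) ^ 3

/-- Put u = (1 + t)(1 + t²) and w = t (t² + t + 1). Then f = A u⁴ - 2⁶ w³ and u = w + 1, so 4 u' f -
u f' = 2⁶ w² w' (3 - w). A double root cannot have w = 0 because A ≠ 0. If w = 3 then u = 4 and f =
2⁶ (4A - 27); if w' = 0 then u = 4 t³, w = 3 t⁴ and f = 2⁶ (4A - 27) t¹². -/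
theorem separable_hyperellipticPoly {A : K} (h2 : (2 : K) ≠ 0) (hA : A ≠ 0)
    (hA' : 4 * A ≠ 27) : (hyperellipticPoly A).Separable := by
  apply separable_of_no_common_root
  intro t hr hr'
  have inj := (algebraMap K (AlgebraicClosure K)).injective
  replace h2 : (2 : AlgebraicClosure K) ≠ 0 := by simpa [map_ofNat] using inj.ne h2
  replace hA : algebraMap K (AlgebraicClosure K) A ≠ 0 := by simpa using inj.ne hA
  replace hA' : 4 * algebraMap K (AlgebraicClosure K) A ≠ 27 := by simpa [map_ofNat] using inj.ne hA'
  simp [hyperellipticPoly, derivative_pow, map_ofNat] at hr hr'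
  set a := algebraMap K (AlgebraicClosure K) A
  have hu : (1 + t) * (1 + t ^ 2) ≠ 0 := by
    intro hu
    have h1 : 2 ^ 6 * (t * (t ^ 2 + t + 1)) ^ 3 = 0 := by
      linear_combination -hr + a * ((1 + t) * (1 + t ^ 2)) ^ 3 * hu
    have h4 : t * (t ^ 2 + t + 1) = 0 := by simpa [h2] using h1
    have h5 : (1 : AlgebraicClosure K) = 0 := by linear_combination hu - h4
    exact one_ne_zero h5
  have ht : t ≠ 0 := by
    rintro rfl
    exact hA (by linear_combination hr)
  have hw : t ^ 2 + t + 1 ≠ 0 := by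
    intro hw
    have h1 : a * ((1 + t) * (1 + t ^ 2)) ^ 4 = 0 := by
      linear_combination hr + 2 ^ 6 * t ^ 3 * (t ^ 2 + t + 1) ^ 2 * hw
    exact mul_ne_zero hA (pow_ne_zero 4 hu) h1
  -- Here (1 - t)(t² + 2t + 3) = 3 - w and 3t² + 2t + 1 = w'.
  have key : (2 ^ 6 * (t * (t ^ 2 + t + 1)) ^ 2) * ((1 - t) * ((t ^ 2 + 2 * t + 3)
      * (3 * t ^ 2 + 2 * t + 1))) = 0 := by
    linear_combination 4 * (1 + 2 * t + 3 * t ^ 2) * hr - (1 + t) * (1 + t ^ 2) * hr'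
  have h0 : 2 ^ 6 * (t * (t ^ 2 + t + 1)) ^ 2 ≠ 0 := 
    mul_ne_zero (pow_ne_zero 6 h2) (pow_ne_zero 2 (mul_ne_zero ht hw))
  have hc : 2 ^ 6 * (4 * a - 27) ≠ 0 :=
    mul_ne_zero (pow_ne_zero 6 h2) (sub_ne_zero.mpr hA')
  rcases mul_eq_zero.mp ((mul_eq_zero.mp key).resolve_left h0) with h | h
  · obtain rfl : t = 1 := by linear_combination -h
    exact hc (by linear_combination hr)
  rcases mul_eq_zero.mp h with h | h
  · have e1 : (t + 1) * (t ^ 2 + 1) = 4 := by linear_combination (t - 1) * h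
    have e2 : t * (t ^ 2 + t + 1) = 3 := by linear_combination (t - 1) * h
    refine hc ?_
    calc 2 ^ 6 * (4 * a - 27)
        = a * ((t + 1) * (t ^ 2 + 1)) ^ 4 - 2 ^ 6 * (t * (t ^ 2 + t + 1)) ^ 3 := by
          rw [e1, e2]; ring
      _ = 0 := by linear_combination hr
  · have e1 : (t + 1) * (t ^ 2 + 1) = 4 * t ^ 3 := by linear_combination (1 - t) * h
    have e2 : t ^ 2 + t + 1 = 3 * t ^ 3 := by linear_combination (1 - t) * h
    refine mul_ne_zero hc (pow_ne_zero 12 ht) ?_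
    calc 2 ^ 6 * (4 * a - 27) * t ^ 12
        = a * ((t + 1) * (t ^ 2 + 1)) ^ 4 - 2 ^ 6 * (t * (t ^ 2 + t + 1)) ^ 3 := by
          rw [e1, e2]; ring
      _ = 0 := by linear_combination hr

end Separable

/-! ### The space curve inside the function field of the curve of genus `5` -/

namespace QuadraticCover

variable {K : Type*} [Field K] (H : QuadraticCover K)

/-- The coordinate function `x` of the space curve. -/
noncomputable def spaceX : H.FunctionField := cubicX H.x

/-- The coordinate function `z` of the space curve. -/
noncomputable def spaceZ : H.FunctionField := H.x * cubicX H.x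

/-- The coordinate function `y` of the space curve. -/
noncomputable def spaceY : H.FunctionField := H.y / (8 * ((1 + H.x) * (1 + H.x ^ 2)) ^ 2)

variable {A : K}

theorem denom_ne_zero : (1 + H.x) * (1 + H.x ^ 2) ≠ 0 := by
  intro h
  refine H.transcendental_x (IsAlgebraic.of_algebraicClosure (IsAlgebraic.of_cubic _ (one_mem _)
    (one_mem _) (one_mem _) (one_mem _) (Or.inl one_ne_zero) (?_)))
  linear_combination h

theorem spaceX_mul : H.spaceX * ((1 + H.x) * (1 + H.x ^ 2)) + (1 + H.x + H.x ^ 2) = 0 :=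
  cubicX_mul H.denom_ne_zero

theorem spaceZ_eq : H.spaceZ = H.x * H.spaceX := rfl

theorem spaceX_spaceZ : (H.spaceX ^ 3 + H.spaceX ^ 2 * H.spaceZ + H.spaceX * H.spaceZ ^ 2
    + H.spaceZ ^ 3) + (H.spaceX ^ 2 + H.spaceX * H.spaceZ + H.spaceZ ^ 2) = 0 := by
  rw [spaceZ_eq]
  linear_combination H.spaceX ^ 2 * H.spaceX_mul

theorem x_ne_zero : H.x ≠ 0 := by
  simpa using H.transcendental_x.ne_algebraMap 0

theorem spaceX_ne_zero : H.spaceX ≠ 0 := by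
  intro h
  have h1 := H.spaceX_mul
  rw [h] at h1
  refine H.transcendental_x (IsAlgebraic.of_algebraicClosure (IsAlgebraic.of_cubic _ (zero_mem _)
    (one_mem _) (one_mem _) (one_mem _) (Or.inr one_ne_zero) (?_)))
  linear_combination h1

variable {H}

theorem eight_ne_zero (h2 : (2 : K) ≠ 0) {L : Type*} [Field L] [Algebra K L] : (8 : L) ≠ 0 := by
  have h : (8 : K) ≠ 0 := by
    rw [show (8 : K) = 2 ^ 3 by norm_num]
    exact pow_ne_zero 3 h2
  simpa [map_ofNat] using (algebraMap K L).injective.ne h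

theorem spaceY_mul (h2 : (2 : K) ≠ 0) :
    H.spaceY * (8 * ((1 + H.x) * (1 + H.x ^ 2)) ^ 2) = H.y :=
  div_mul_cancel₀ _ (mul_ne_zero (eight_ne_zero h2) (pow_ne_zero 2 H.denom_ne_zero))

theorem aeval_hyperellipticPoly {L : Type*} [Field L] [Algebra K L] (A : K) (t : L) :
    aeval t (hyperellipticPoly A) = algebraMap K L A * ((1 + t) * (1 + t ^ 2)) ^ 4
      - 2 ^ 6 * (t * (1 + t + t ^ 2)) ^ 3 := by
  simp [hyperellipticPoly, map_ofNat]
  ring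

theorem algebraMap_div_two_pow {L : Type*} [Field L] [Algebra K L] (A : K) :
    algebraMap K L (A / 2 ^ 6) = algebraMap K L A / 2 ^ 6 := by
  simp [map_ofNat]

/-- For x = `cubicX t` one has x + 1 = t³ / u, hence x⁴ + x³ = -(t (1 + t + t²))³ / u⁴; the factor 8
in `spaceY` absorbs 2⁶. -/
theorem spaceY_sq (h2 : (2 : K) ≠ 0) (hH : H.f = hyperellipticPoly A) :
    H.spaceY ^ 2 = H.spaceX ^ 4 + H.spaceX ^ 3 + algebraMap K _ (A / 2 ^ 6) := by
  have h8 : (8 : H.FunctionField) ≠ 0 := eight_ne_zero h2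
  have h2' : (2 : H.FunctionField) ≠ 0 := fun h => h8 (by linear_combination 4 * h)
  have hu := H.denom_ne_zero
  have h := H.y_sq.trans (congrArg (aeval H.x) hH)
  rw [aeval_hyperellipticPoly] at h
  rw [spaceY, spaceX, cubicX, algebraMap_div_two_pow, div_pow, h]
  generalize algebraMap K H.FunctionField A = a
  generalize H.x = t at hu ⊢
  obtain ⟨hu1, hu2⟩ := mul_ne_zero_iff.mp hu
  rw [show (8 : H.FunctionField) = 2 ^ 3 by norm_num]
  field_simp
  ring

theorem transcendental_of_quartic {L : Type*} [Field L] [Algebra K L] {a w : L} {B : K}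
    (h : w ^ 2 = a ^ 4 + a ^ 3 + algebraMap K L B) (hw : Transcendental K w) :
    Transcendental K a := by
  intro ha
  apply hw
  have : IsAlgebraic K (w ^ 2) := by
    rw [h]
    exact ((ha.pow 4).add (ha.pow 3)).add (isAlgebraic_algebraMap B)
  exact IsAlgebraic.of_pow two_pos this

theorem transcendental_of_quartic' {L : Type*} [Field L] [Algebra K L] {a w : L} {B : K}
    (h : w ^ 2 = a ^ 4 + a ^ 3 + algebraMap K L B) (ha : Transcendental K a) :
    Transcendental K w := by
  intro hw
  refine ha (IsAlgebraic.of_algebraicClosure (IsAlgebraic.of_quartic _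
    (d := algebraMap K L B - w ^ 2) ?_ ?_))
  · exact sub_mem (algebraMap_mem _ B) (pow_mem (by rwa [mem_algebraicClosure_iff]) 2)
  · linear_combination -h

theorem transcendental_of_slope {L : Type*} [Field L] [Algebra K L] {a t : L}
    (h : a * ((1 + t) * (1 + t ^ 2)) + (1 + t + t ^ 2) = 0) (ha : Transcendental K a) :
    Transcendental K t := by
  intro ht
  apply ha
  rw [eq_cubicX h]
  rw [← mem_algebraicClosure_iff] at ht ⊢
  exact div_mem (neg_mem (add_mem (add_mem (one_mem _) ht) (pow_mem ht 2)))
    (mul_mem (add_mem (one_mem _) ht) (add_mem (one_mem _) (pow_mem ht 2)))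

variable (H) in
theorem transcendental_spaceX : Transcendental K H.spaceX := by
  intro h
  rw [← mem_algebraicClosure_iff] at h
  refine H.transcendental_x (IsAlgebraic.of_algebraicClosure (IsAlgebraic.of_cubic _ h
    (add_mem h (one_mem _)) (add_mem h (one_mem _)) (add_mem h (one_mem _))
    (Or.inl H.spaceX_ne_zero) ?_))
  linear_combination H.spaceX_mul

/-- The cubic times x - z is the difference of the values of T⁴ + T³ at x and z. -/
theorem spaceZ_sq (h2 : (2 : K) ≠ 0) (hH : H.f = hyperellipticPoly A) :
    H.spaceY ^ 2 = H.spaceZ ^ 4 + H.spaceZ ^ 3 + algebraMap K _ (A / 2 ^ 6) := by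
  linear_combination spaceY_sq h2 hH + (H.spaceX - H.spaceZ) * H.spaceX_spaceZ

theorem transcendental_spaceY (h2 : (2 : K) ≠ 0) (hH : H.f = hyperellipticPoly A) :
    Transcendental K H.spaceY :=
  transcendental_of_quartic' (spaceY_sq h2 hH) H.transcendental_spaceX

theorem transcendental_spaceZ (h2 : (2 : K) ≠ 0) (hH : H.f = hyperellipticPoly A) :
    Transcendental K H.spaceZ :=
  transcendental_of_quartic (spaceZ_sq h2 hH) (transcendental_spaceY h2 hH)

/-- A point of the space curve with transcendental `y`-coordinate is generic. -/
theorem exists_embedding (h2 : (2 : K) ≠ 0) (hH : H.f = hyperellipticPoly A)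
    {L : Type*} [Field L] [Algebra K L] {a b w : L} (hw : Transcendental K w)
    (h1 : w ^ 2 = a ^ 4 + a ^ 3 + algebraMap K L (A / 2 ^ 6))
    (h3 : (a ^ 3 + a ^ 2 * b + a * b ^ 2 + b ^ 3) + (a ^ 2 + a * b + b ^ 2) = 0) :
    ∃ φ : H.FunctionField →ₐ[K] L, φ H.spaceX = a ∧ φ H.spaceZ = b ∧ φ H.spaceY = w := by
  have ha := transcendental_of_quartic h1 hw
  have ha0 : a ≠ 0 := by simpa using ha.ne_algebraMap 0
  obtain ⟨t, rfl⟩ : ∃ t, b = a * t := ⟨b / a, by field_simp⟩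
  have h4 : a * ((1 + t) * (1 + t ^ 2)) + (1 + t + t ^ 2) = 0 := by
    apply mul_left_cancel₀ (pow_ne_zero 2 ha0)
    linear_combination h3
  have ht := transcendental_of_slope h4 ha
  have hu := denom_ne_zero_of_mul_add_eq_zero h4
  have h8 : (8 : L) ≠ 0 := eight_ne_zero h2
  have h2' : (2 : L) ≠ 0 := fun h => h8 (by linear_combination 4 * h)
  have hY : (w * (8 * ((1 + t) * (1 + t ^ 2)) ^ 2)) ^ 2 = aeval t H.f := by
    rw [hH, aeval_hyperellipticPoly, mul_pow, h1, algebraMap_div_two_pow, eq_cubicX h4, cubicX]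
    obtain ⟨hu1, hu2⟩ := mul_ne_zero_iff.mp hu
    field_simp
    ring
  have hX : H.lift ht hY H.spaceX = a := by
    rw [eq_cubicX h4, spaceX, cubicX, cubicX]
    simp
  refine ⟨H.lift ht hY, hX, ?_, ?_⟩
  · rw [spaceZ_eq, map_mul, hX, lift_x, mul_comm]
  · rw [spaceY]
    simp only [map_div₀, map_mul, map_pow, map_add, map_one, lift_x, lift_y, map_ofNat]
    rw [mul_div_assoc, div_self (mul_ne_zero h8 (pow_ne_zero 2 hu)), mul_one]

theorem algebraicClosure_eq_top_of_mem (h2 : (2 : K) ≠ 0) (M : IntermediateField K H.FunctionField)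
    (hx : IsAlgebraic M H.x) (hy : H.spaceY ∈ M) : Algebra.IsAlgebraic M H.FunctionField := by
  apply IsAlgebraic.of_adjoin_eq_top M H.adjoin_eq_top
  rintro s (rfl | rfl)
  · exact hx
  · rw [← spaceY_mul h2]
    rw [← mem_algebraicClosure_iff] at hx ⊢
    refine mul_mem (algebraMap_mem (algebraicClosure M H.FunctionField) (⟨_, hy⟩ : M))
      (mul_mem (ofNat_mem _ 8) (pow_mem (mul_mem (add_mem (one_mem _) hx)
      (add_mem (one_mem _) (pow_mem hx 2))) 2))

theorem isAlgebraic_of_spaceX_mem (h2 : (2 : K) ≠ 0) (M : IntermediateField K H.FunctionField)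
    (hx : H.spaceX ∈ M) (hy : H.spaceY ∈ M) : Algebra.IsAlgebraic M H.FunctionField := by
  refine algebraicClosure_eq_top_of_mem h2 M (IsAlgebraic.of_cubic _ hx
    (add_mem hx (one_mem _)) (add_mem hx (one_mem _)) (add_mem hx (one_mem _))
    (Or.inl H.spaceX_ne_zero) ?_) hy
  linear_combination H.spaceX_mul

/-- Multiplied by t, the slope equation reads (z + 1)(t³ + t² + t) + z = 0, whose constant
coefficient z is not zero. -/
theorem isAlgebraic_of_spaceZ_mem (h2 : (2 : K) ≠ 0) (M : IntermediateField K H.FunctionField)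
    (hz : H.spaceZ ∈ M) (hy : H.spaceY ∈ M) : Algebra.IsAlgebraic M H.FunctionField := by
  refine algebraicClosure_eq_top_of_mem h2 M (IsAlgebraic.of_cubic _ (add_mem hz (one_mem _))
    (add_mem hz (one_mem _)) (add_mem hz (one_mem _)) hz
    (Or.inr (mul_ne_zero H.x_ne_zero H.spaceX_ne_zero)) ?_) hy
  rw [spaceZ_eq]
  linear_combination H.x * H.spaceX_mul

end QuadraticCover

/-! ### The space curve is integral, and its function field is that of the hyperelliptic curve -/

section PlaneCubic

variable {K : Type*} [Field K]

/-- The equation of the plane cubic, as a polynomial in `z` over `K[x]`. -/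
noncomputable def planeCubic (K : Type*) [Field K] : K[X][X] :=
  X ^ 3 + (C (X + 1) * X ^ 2 + C (X * (X + 1)) * X + C (X ^ 2 * (X + 1)))

theorem planeCubic_degree_lt :
    degree (C (X + 1) * X ^ 2 + C (X * (X + 1)) * X + C (X ^ 2 * (X + 1)) : K[X][X]) < 3 :=
  degree_quadratic_lt

theorem planeCubic_natDegree : (planeCubic K).natDegree = 3 := by
  rw [planeCubic, natDegree_add_eq_left_of_degree_lt, natDegree_X_pow]
  rw [degree_X_pow]
  exact planeCubic_degree_lt

theorem planeCubic_monic : (planeCubic K).Monic :=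
  monic_X_pow_add planeCubic_degree_lt

theorem prime_X_add_one : Prime (X + 1 : K[X]) := by
  have := prime_X_sub_C (-1 : K)
  rwa [C_neg, C_1, sub_neg_eq_add] at this

/-- Eisenstein at x + 1, which divides the constant coefficient x² (x + 1) exactly once. -/
theorem planeCubic_irreducible : Irreducible (planeCubic K) := by
  have hP : (Ideal.span {(X + 1 : K[X])}).IsPrime :=
    (Ideal.span_singleton_prime prime_X_add_one.ne_zero).mpr prime_X_add_one
  have hc : ∀ n, (planeCubic K).coeff n = if n = 3 then 1 else if n = 2 then X + 1 else
      if n = 1 then X * (X + 1) else if n = 0 then X ^ 2 * (X + 1) else 0 := by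
    intro n
    simp only [planeCubic, coeff_add, coeff_X_pow, coeff_C_mul, coeff_X, coeff_C]
    rcases n with _ | _ | _ | _ | n <;> simp
  refine IsEisensteinAt.irreducible (𝓟 := Ideal.span {(X + 1 : K[X])}) ⟨?_, ?_, ?_⟩ hP
    planeCubic_monic.isPrimitive (by rw [planeCubic_natDegree]; norm_num)
  · rw [planeCubic_monic.leadingCoeff]
    exact fun h => hP.ne_top ((Ideal.eq_top_iff_one _).mpr h)
  · intro n hn
    rw [planeCubic_natDegree] at hn
    rw [hc, Ideal.mem_span_singleton]
    interval_cases n <;> simp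
  · rw [hc, Ideal.span_singleton_pow, Ideal.mem_span_singleton]
    simp only [if_true, OfNat.zero_ne_ofNat, if_false, zero_ne_one]
    rw [pow_two, mul_dvd_mul_iff_right prime_X_add_one.ne_zero]
    intro h
    have := eval_dvd (x := (-1 : K)) h
    simp at this

/-- As a is transcendental, K[a] is a polynomial ring; by irreducibility the minimal polynomial of b
over it has degree 3, so it divides no nonzero polynomial of degree at most 2. -/
theorem planeCubic_independent {L : Type*} [Field L] [Algebra K L] {a b : L}
    (ha : Transcendental K a)
    (hab : (a ^ 3 + a ^ 2 * b + a * b ^ 2 + b ^ 3) + (a ^ 2 + a * b + b ^ 2) = 0) {p q r : K[X]}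
    (h : aeval a p + aeval a q * b + aeval a r * b ^ 2 = 0) : p = 0 ∧ q = 0 ∧ r = 0 := by
  let _ : Algebra K[X] L := (aeval a : K[X] →ₐ[K] L).toRingHom.toAlgebra
  have hmap : ∀ p : K[X], algebraMap K[X] L p = aeval a p := fun _ => rfl
  have : FaithfulSMul K[X] L := (faithfulSMul_iff_algebraMap_injective _ _).mpr
    (QuadraticCover.aeval_injective ha)
  have hG : aeval b (planeCubic K) = 0 := by
    simp [planeCubic, hmap]
    linear_combination hab
  have hint : IsIntegral K[X] b := ⟨_, planeCubic_monic, hG⟩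
  have hdvd := minpoly.isIntegrallyClosed_dvd hint hG
  have hdeg : (minpoly K[X] b).natDegree = 3 := by
    rw [← planeCubic_natDegree (K := K)]
    obtain ⟨c, hc⟩ := hdvd
    rcases planeCubic_irreducible.isUnit_or_isUnit hc with hu | hu
    · exact absurd hu (minpoly.not_isUnit _ _)
    · have h0 : c.natDegree = 0 := natDegree_eq_zero_of_isUnit hu
      rw [hc, natDegree_mul (minpoly.ne_zero hint) hu.ne_zero, h0, add_zero]
  have h2 : aeval b (C r * X ^ 2 + C q * X + C p) = 0 := by
    simp [hmap]
    linear_combination h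
  have h3 : C r * X ^ 2 + C q * X + C p = 0 := by
    apply eq_zero_of_dvd_of_natDegree_lt (minpoly.isIntegrallyClosed_dvd hint h2)
    rw [hdeg]
    exact Nat.lt_succ_of_le natDegree_quadratic_le
  have c0 := congrArg (fun s => coeff s 0) h3
  have c1 := congrArg (fun s => coeff s 1) h3
  have c2 := congrArg (fun s => coeff s 2) h3
  simp [coeff_X, coeff_C] at c0 c1 c2
  exact ⟨c0, c1, c2⟩

end PlaneCubic

section SpaceCurve

variable {K : Type*} [Field K] {B : K}

theorem spaceCurveCoord_quartic : spaceCurveCoord B 1 ^ 2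
    = spaceCurveCoord B 0 ^ 4 + spaceCurveCoord B 0 ^ 3 + algebraMap K _ B := by
  rw [← sub_eq_zero]
  exact Ideal.Quotient.eq_zero_iff_mem.mpr (Ideal.subset_span (Set.mem_insert _ _))

theorem spaceCurveCoord_cubic : (spaceCurveCoord B 0 ^ 3
    + spaceCurveCoord B 0 ^ 2 * spaceCurveCoord B 2
    + spaceCurveCoord B 0 * spaceCurveCoord B 2 ^ 2 + spaceCurveCoord B 2 ^ 3)
    + (spaceCurveCoord B 0 ^ 2 + spaceCurveCoord B 0 * spaceCurveCoord B 2
      + spaceCurveCoord B 2 ^ 2) = 0 :=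
  Ideal.Quotient.eq_zero_iff_mem.mpr (Ideal.subset_span (Set.mem_insert_of_mem _ rfl))

/-- One equation is monic of degree 2 in y and the other monic of degree 3 in z, so powers of y and
z reduce over K[x]. -/
theorem spaceCurve_exists_normal_form (r : SpaceCurveRing B) : ∃ p₀ p₁ p₂ q₀ q₁ q₂ : K[X],
    r = aeval (spaceCurveCoord B 0) p₀ + aeval (spaceCurveCoord B 0) p₁ * spaceCurveCoord B 2
      + aeval (spaceCurveCoord B 0) p₂ * spaceCurveCoord B 2 ^ 2
      + (aeval (spaceCurveCoord B 0) q₀ + aeval (spaceCurveCoord B 0) q₁ * spaceCurveCoord B 2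
      + aeval (spaceCurveCoord B 0) q₂ * spaceCurveCoord B 2 ^ 2) * spaceCurveCoord B 1 := by
  obtain ⟨g, rfl⟩ := Ideal.Quotient.mk_surjective r
  induction g using MvPolynomial.induction_on with
  | C c =>
    refine ⟨C c, 0, 0, 0, 0, 0, ?_⟩
    simp only [aeval_C, map_zero, zero_mul, add_zero]
    rfl
  | add f g hf hg =>
    obtain ⟨p₀, p₁, p₂, q₀, q₁, q₂, hf⟩ := hf
    obtain ⟨r₀, r₁, r₂, s₀, s₁, s₂, hg⟩ := hg
    refine ⟨p₀ + r₀, p₁ + r₁, p₂ + r₂, q₀ + s₀, q₁ + s₁, q₂ + s₂, ?_⟩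
    rw [map_add, hf, hg]
    simp only [map_add]
    ring
  | mul_X f i hf =>
    obtain ⟨p₀, p₁, p₂, q₀, q₁, q₂, hf⟩ := hf
    rw [map_mul, hf, ← spaceCurveCoord]
    have hc := spaceCurveCoord_cubic (B := B)
    have hq := spaceCurveCoord_quartic (B := B)
    obtain rfl | rfl | rfl : i = 0 ∨ i = 1 ∨ i = 2 := by fin_cases i <;> simp
    · refine ⟨X * p₀, X * p₁, X * p₂, X * q₀, X * q₁, X * q₂, ?_⟩
      simp only [map_mul, aeval_X]
      ring
    · refine ⟨q₀ * (X ^ 4 + X ^ 3 + C B), q₁ * (X ^ 4 + X ^ 3 + C B), q₂ * (X ^ 4 + X ^ 3 + C B),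
        p₀, p₁, p₂, ?_⟩
      simp only [map_mul, map_add, map_pow, aeval_X, aeval_C]
      generalize spaceCurveCoord B 0 = x at hq ⊢
      generalize spaceCurveCoord B 2 = z
      generalize spaceCurveCoord B 1 = y at hq ⊢
      linear_combination (aeval x q₀ + aeval x q₁ * z + aeval x q₂ * z ^ 2) * hq
    -- The substitution is z³ = -(x + 1) z² - x (x + 1) z - x² (x + 1).
    · refine ⟨-X ^ 2 * (X + 1) * p₂, p₀ - X * (X + 1) * p₂, p₁ - (X + 1) * p₂,
        -X ^ 2 * (X + 1) * q₂, q₀ - X * (X + 1) * q₂, q₁ - (X + 1) * q₂, ?_⟩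
      simp only [map_mul, map_sub, map_add, map_neg, map_pow, map_one, aeval_X]
      generalize spaceCurveCoord B 0 = x at hc ⊢
      generalize spaceCurveCoord B 2 = z at hc ⊢
      generalize spaceCurveCoord B 1 = y
      linear_combination (aeval x p₂ + aeval x q₂ * y) * hc

namespace QuadraticCover

variable (H : QuadraticCover K) {A : K}

/-- The map from the coordinate ring of the space curve to the function field of the hyperelliptic
curve. -/
noncomputable def spaceCurveMap (h2 : (2 : K) ≠ 0) (hH : H.f = hyperellipticPoly A) :
    SpaceCurveRing (A / 2 ^ 6) →ₐ[K] H.FunctionField :=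
  Ideal.Quotient.liftₐ (spaceCurveIdeal (A / 2 ^ 6))
    (MvPolynomial.aeval ![H.spaceX, H.spaceY, H.spaceZ]) <| by
      have hle : spaceCurveIdeal (A / 2 ^ 6)
          ≤ RingHom.ker (MvPolynomial.aeval (R := K) ![H.spaceX, H.spaceY, H.spaceZ]) := by
        rw [spaceCurveIdeal, Ideal.span_le]
        rintro _ (rfl | rfl)
        · rw [SetLike.mem_coe, RingHom.mem_ker]
          simp only [map_sub, map_add, map_pow, MvPolynomial.aeval_X, MvPolynomial.aeval_C]
          exact sub_eq_zero.mpr (spaceY_sq h2 hH)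
        · rw [SetLike.mem_coe, RingHom.mem_ker]
          simp only [map_mul, map_add, map_pow, MvPolynomial.aeval_X]
          exact H.spaceX_spaceZ
      exact fun a ha => hle ha

variable (h2 : (2 : K) ≠ 0) (hH : H.f = hyperellipticPoly A)

theorem spaceCurveMap_coord (i : Fin 3) : H.spaceCurveMap h2 hH (spaceCurveCoord _ i)
    = ![H.spaceX, H.spaceY, H.spaceZ] i := by
  change MvPolynomial.aeval (R := K) ![H.spaceX, H.spaceY, H.spaceZ] (MvPolynomial.X i) = _
  rw [MvPolynomial.aeval_X]

theorem exists_conj : ∃ φ : H.FunctionField →ₐ[K] H.FunctionField, φ H.x = H.x ∧ φ H.y = -H.y :=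
  ⟨H.lift H.transcendental_x (by rw [neg_sq, y_sq]), by simp, by simp⟩

/-- The involution y ↦ -y separates the even and odd parts of the normal form, and
`planeCubic_independent` kills each. -/
theorem spaceCurveMap_injective : Function.Injective (H.spaceCurveMap h2 hH) := by
  rw [injective_iff_map_eq_zero]
  intro r hr
  obtain ⟨p₀, p₁, p₂, q₀, q₁, q₂, rfl⟩ := spaceCurve_exists_normal_form r
  have hx : H.spaceCurveMap h2 hH (spaceCurveCoord _ 0) = H.spaceX := H.spaceCurveMap_coord h2 hH 0
  have hy : H.spaceCurveMap h2 hH (spaceCurveCoord _ 1) = H.spaceY := H.spaceCurveMap_coord h2 hH 1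
  have hz : H.spaceCurveMap h2 hH (spaceCurveCoord _ 2) = H.spaceZ := H.spaceCurveMap_coord h2 hH 2
  simp only [map_add, map_mul, map_pow, ← Polynomial.aeval_algHom_apply, hx, hy, hz] at hr
  obtain ⟨φ, hφx, hφy⟩ := H.exists_conj
  have ex : φ H.spaceX = H.spaceX := by
    simp [spaceX, cubicX, hφx]
  have ez : φ H.spaceZ = H.spaceZ := by
    rw [spaceZ_eq, map_mul, hφx, ex]
  have ey : φ H.spaceY = -H.spaceY := by
    simp [spaceY, hφx, hφy, map_ofNat, neg_div]
  have hr' := congrArg φ hr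
  simp only [map_add, map_mul, map_pow, ← Polynomial.aeval_algHom_apply, ex, ey, ez, map_zero]
    at hr'
  have h2' : (2 : H.FunctionField) ≠ 0 := fun h =>
    eight_ne_zero h2 (L := H.FunctionField) (by linear_combination 4 * h)
  have hp : aeval H.spaceX p₀ + aeval H.spaceX p₁ * H.spaceZ
      + aeval H.spaceX p₂ * H.spaceZ ^ 2 = 0 := by
    apply (mul_eq_zero.mp _).resolve_left h2'
    linear_combination hr + hr'
  have hq : aeval H.spaceX q₀ + aeval H.spaceX q₁ * H.spaceZ
      + aeval H.spaceX q₂ * H.spaceZ ^ 2 = 0 := by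
    have hY : H.spaceY ≠ 0 := by
      simpa using (transcendental_spaceY h2 hH).ne_algebraMap 0
    apply (mul_eq_zero.mp _).resolve_right (mul_ne_zero h2' hY)
    linear_combination hr - hr'
  obtain ⟨rfl, rfl, rfl⟩ := planeCubic_independent H.transcendental_spaceX H.spaceX_spaceZ hp
  obtain ⟨rfl, rfl, rfl⟩ := planeCubic_independent H.transcendental_spaceX H.spaceX_spaceZ hq
  simp

theorem spaceCurveMap_isFunctionFieldEmbedding :
    IsFunctionFieldEmbedding (H.spaceCurveMap h2 hH) := by
  refine ⟨H.spaceCurveMap_injective h2 hH, fun h => ?_⟩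
  let M := IntermediateField.adjoin K ((H.spaceCurveMap h2 hH).range : Set H.FunctionField)
  have hmem : ∀ i, ![H.spaceX, H.spaceY, H.spaceZ] i ∈ M := fun i =>
    IntermediateField.subset_adjoin _ _ ⟨_, H.spaceCurveMap_coord h2 hH i⟩
  have hx : H.x ∈ M := by
    have : H.x = H.spaceZ / H.spaceX := by
      rw [spaceZ_eq, mul_div_cancel_right₀ _ H.spaceX_ne_zero]
    rw [this]
    exact div_mem (hmem 2) (hmem 0)
  have hy : H.y ∈ M := by
    rw [← spaceY_mul h2]
    exact mul_mem (hmem 1) (mul_mem (ofNat_mem _ 8) (pow_mem (mul_mem (add_mem (one_mem _) hx)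
      (add_mem (one_mem _) (pow_mem hx 2))) 2))
  have htop : M = ⊤ := by
    rw [eq_top_iff, ← H.adjoin_eq_top, IntermediateField.adjoin_le_iff]
    rintro _ (rfl | rfl)
    · exact hx
    · exact hy
  have hh : h ∈ M := htop ▸ IntermediateField.mem_top
  rw [IntermediateField.mem_adjoin_iff_div, Algebra.adjoin_eq] at hh
  obtain ⟨_, ⟨a, rfl⟩, _, ⟨b, rfl⟩, rfl⟩ := hh
  -- With a zero denominator the quotient is 0 by convention, and 0 / 1 represents it.
  by_cases hb : H.spaceCurveMap h2 hH b = 0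
  · exact ⟨0, 1, by simp, by simp [hb]⟩
  · exact ⟨a, b, hb, rfl⟩

end QuadraticCover

end SpaceCurve

/-! ### The curve `y² = x⁴ + x³ + A / 2⁶` is isomorphic to `y² = x³ - A x + A` -/

section FunctionField

variable {K : Type*} [Field K] (E : WeierstrassCurve.Affine K)

namespace WeierstrassCurve.Affine

/-- The coordinate function `x` of a Weierstrass curve. -/
noncomputable def FunctionField.x : E.FunctionField :=
  algebraMap E.CoordinateRing E.FunctionField (CoordinateRing.mk E (C X))

/-- The coordinate function `y` of a Weierstrass curve. -/
noncomputable def FunctionField.y : E.FunctionField :=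
  algebraMap E.CoordinateRing E.FunctionField (CoordinateRing.mk E X)

theorem FunctionField.algebraMap_mk_C (p : K[X]) :
    algebraMap E.CoordinateRing E.FunctionField (CoordinateRing.mk E (C p))
      = aeval (FunctionField.x E) p := by
  induction p using Polynomial.induction_on' with
  | add p q hp hq => rw [C_add, map_add, map_add, hp, hq, map_add]
  | monomial n a =>
    rw [aeval_monomial, ← C_mul_X_pow_eq_monomial, C_mul, map_mul, map_mul, C_pow, map_pow, map_pow]
    rfl

theorem FunctionField.transcendental_x : Transcendental K (FunctionField.x E) := by
  rw [transcendental_iff_injective]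
  intro p q h
  rw [← FunctionField.algebraMap_mk_C, ← FunctionField.algebraMap_mk_C] at h
  have h1 := IsFractionRing.injective E.CoordinateRing E.FunctionField h
  exact FaithfulSMul.algebraMap_injective K[X] E.CoordinateRing h1

theorem FunctionField.adjoin_eq_top :
    IntermediateField.adjoin K {FunctionField.x E, FunctionField.y E} = ⊤ := by
  rw [eq_top_iff]
  intro h _
  set M := IntermediateField.adjoin K {FunctionField.x E, FunctionField.y E}
  have hx : FunctionField.x E ∈ M := IntermediateField.subset_adjoin _ _ (by simp)
  have hy : FunctionField.y E ∈ M := IntermediateField.subset_adjoin _ _ (by simp)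
  have hp : ∀ p : K[X], aeval (FunctionField.x E) p ∈ M := fun p =>
    Algebra.adjoin_le (S := M.toSubalgebra) (by simpa using hx) (aeval_mem_adjoin_singleton K _)
  have hr : ∀ r : E.CoordinateRing, algebraMap E.CoordinateRing E.FunctionField r ∈ M := by
    intro r
    obtain ⟨p, q, rfl⟩ := CoordinateRing.exists_smul_basis_eq r
    rw [CoordinateRing.smul, CoordinateRing.smul, mul_one, map_add, map_mul,
      FunctionField.algebraMap_mk_C, FunctionField.algebraMap_mk_C]
    exact add_mem (hp _) (mul_mem (hp _) hy)
  obtain ⟨a, b, -, rfl⟩ := IsFractionRing.div_surjective (A := E.CoordinateRing) h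
  exact div_mem (hr _) (hr _)

theorem FunctionField.equation : (E.baseChange E.FunctionField).Equation
    (FunctionField.x E) (FunctionField.y E) := by
  have h : CoordinateRing.mk E E.polynomial = 0 := AdjoinRoot.mk_self
  have h1 : algebraMap E.CoordinateRing E.FunctionField (CoordinateRing.mk E
      (X ^ 2 + C (C E.a₁ * X + C E.a₃) * X - C (X ^ 3 + C E.a₂ * X ^ 2 + C E.a₄ * X + C E.a₆)))
      = 0 := by
    rw [← map_zero (algebraMap E.CoordinateRing E.FunctionField), ← h]
    rfl
  rw [map_sub, map_add, map_mul, map_pow, map_sub, map_add, map_mul, map_pow,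
    FunctionField.algebraMap_mk_C, FunctionField.algebraMap_mk_C, ← FunctionField.y] at h1
  rw [equation_iff]
  simp at h1
  simp [baseChange, WeierstrassCurve.baseChange]
  linear_combination h1

end WeierstrassCurve.Affine

end FunctionField

section Isomorphism

open WeierstrassCurve.Affine

variable {K : Type*} [Field K] {A : K} {E : WeierstrassCurve K}

theorem weierstrass_sq (hE : E = ⟨0, 0, 0, -A, A⟩) : FunctionField.y E.toAffine ^ 2 = FunctionField.x E.toAffine ^ 3
    - algebraMap K _ A * FunctionField.x E.toAffine + algebraMap K _ A := by
  have h := FunctionField.equation E.toAffine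
  rw [equation_iff] at h
  subst hE
  simp [WeierstrassCurve.Affine.baseChange, WeierstrassCurve.baseChange,
    WeierstrassCurve.toAffine] at h
  linear_combination h

/-- Projection from the point (1, 1), which lies on E for every A. The line of slope 4u + 1 through
it meets E in two more points, whose x-coordinates have sum (4u + 1)² - 1 = 16u² + 8u; they are 8u²
+ 4u ± 8v, and v² is the quartic in u. -/
theorem exists_weierstrass_equiv (hE : E = ⟨0, 0, 0, -A, A⟩) (D : QuadraticCover K)
    (hD : D.f = X ^ 4 + X ^ 3 + C (A / 2 ^ 6)) (h2 : (2 : K) ≠ 0) :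
    ∃ φ : D.FunctionField →ₐ[K] E.toAffine.FunctionField,
    Function.Bijective φ := by
  have hsq := weierstrass_sq hE
  have htr := FunctionField.transcendental_x E.toAffine
  have htop := FunctionField.adjoin_eq_top E.toAffine
  generalize FunctionField.x E.toAffine = x at hsq htr htop
  generalize FunctionField.y E.toAffine = y at hsq htop
  have h8 : (8 : E.toAffine.FunctionField) ≠ 0 := QuadraticCover.eight_ne_zero h2
  have h2' : (2 : E.toAffine.FunctionField) ≠ 0 := fun h => h8 (by linear_combination 4 * h)
  have hx1 : x - 1 ≠ 0 := sub_ne_zero.mpr (by simpa using htr.ne_algebraMap 1)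
  obtain ⟨u, hu⟩ : ∃ u, 4 * u * (x - 1) = y - x :=
    ⟨(y - x) / (4 * (x - 1)), by
      rw [show (4 : E.toAffine.FunctionField) = 2 ^ 2 by norm_num]; field_simp⟩
  obtain ⟨v, hv⟩ : ∃ v, x = 8 * (v + u ^ 2) + 4 * u :=
    ⟨(x - 4 * u) / 8 - u ^ 2, by field_simp; ring⟩
  have hvu : v ^ 2 = u ^ 4 + u ^ 3 + algebraMap K _ (A / 2 ^ 6) := by
    rw [QuadraticCover.algebraMap_div_two_pow]
    have h64 : (-64 : E.toAffine.FunctionField) * (x - 1) ≠ 0 :=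
      mul_ne_zero (by rw [show (-64 : E.toAffine.FunctionField) = -(2 ^ 6) by norm_num]
                      exact neg_ne_zero.mpr (pow_ne_zero 6 h2')) hx1
    apply mul_left_cancel₀ h64
    have hy : y = 4 * u * (x - 1) + x := by linear_combination -hu
    generalize algebraMap K E.toAffine.FunctionField A = a at hsq ⊢
    have h6 : a / 2 ^ 6 * 64 = a := by
      rw [show (64 : E.toAffine.FunctionField) = 2 ^ 6 by norm_num]
      exact div_mul_cancel₀ _ (pow_ne_zero 6 h2')
    generalize a / 2 ^ 6 = b at h6 ⊢
    subst hv hy h6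
    linear_combination hsq
  have hut : Transcendental K u := by
    intro hu'
    apply htr
    have hv' : IsAlgebraic K v := by
      apply IsAlgebraic.of_pow two_pos
      rw [hvu]
      exact ((hu'.pow 4).add (hu'.pow 3)).add (isAlgebraic_algebraMap _)
    rw [hv]
    rw [← mem_algebraicClosure_iff] at hu' hv' ⊢
    exact add_mem (mul_mem (ofNat_mem _ 8) (add_mem hv' (pow_mem hu' 2)))
      (mul_mem (ofNat_mem _ 4) hu')
  have hvu' : v ^ 2 = aeval u D.f := by
    rw [hD, hvu]; simp
  refine ⟨D.lift hut hvu', (D.lift hut hvu').toRingHom.injective, ?_⟩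
  have hu_mem : u ∈ (D.lift hut hvu').fieldRange := ⟨D.x, D.lift_x _ _⟩
  have hv_mem : v ∈ (D.lift hut hvu').fieldRange := ⟨D.y, D.lift_y _ _⟩
  have hx_mem : x ∈ (D.lift hut hvu').fieldRange := by
    rw [hv]
    exact add_mem (mul_mem (ofNat_mem _ 8) (add_mem hv_mem (pow_mem hu_mem 2)))
      (mul_mem (ofNat_mem _ 4) hu_mem)
  have hy_mem : y ∈ (D.lift hut hvu').fieldRange := by
    rw [show y = 4 * u * (x - 1) + x by linear_combination -hu]
    exact add_mem (mul_mem (mul_mem (ofNat_mem _ 4) hu_mem) (sub_mem hx_mem (one_mem _))) hx_mem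
  have hle : (⊤ : IntermediateField K E.toAffine.FunctionField) ≤ (D.lift hut hvu').fieldRange := by
    rw [← htop, IntermediateField.adjoin_le_iff]
    rintro _ (rfl | rfl)
    · exact hx_mem
    · exact hy_mem
  exact fun a => hle (IntermediateField.mem_top (x := a))

theorem exists_curveMap_isIso (hE : E = ⟨0, 0, 0, -A, A⟩) (D : QuadraticCover K)
    (hD : D.f = X ^ 4 + X ^ 3 + C (A / 2 ^ 6)) (h2 : (2 : K) ≠ 0) :
   
    ∃ ψ : CurveMap K D.FunctionField E.toAffine.FunctionField, ψ.IsIso := by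
  obtain ⟨φ, hφ⟩ := exists_weierstrass_equiv hE D hD h2
  let e := (AlgEquiv.ofBijective φ hφ).symm
  refine ⟨CurveMap.ofAlgHom e.toAlgHom ⟨fun a => ?_⟩, CurveMap.ofAlgHom_isIso _ _ e.bijective⟩
  have : a ∈ e.toAlgHom.fieldRange := e.surjective a
  exact isAlgebraic_algebraMap (⟨a, this⟩ : e.toAlgHom.fieldRange)

end Isomorphism

/-! ### There are no nonconstant maps from the line to an elliptic curve -/

section FourSquares

variable {k : Type*} [Field k]

theorem isCoprime_linear_combinations {p q : k[X]} (hpq : IsCoprime p q) {a b c d : k}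
    (h : a * d - b * c ≠ 0) : IsCoprime (C a * p + C b * q) (C c * p + C d * q) := by
  obtain ⟨r, s, hrs⟩ := hpq
  refine ⟨C (a * d - b * c)⁻¹ * (C d * r - C c * s), C (a * d - b * c)⁻¹ * (C a * s - C b * r), ?_⟩
  have h1 : C (a * d - b * c)⁻¹ * (C a * C d - C b * C c) = 1 := by
    rw [← C_mul, ← C_mul, ← C_sub, ← C_mul, inv_mul_cancel₀ h, C_1]
  linear_combination h1 * (r * p + s * q) + hrs

theorem natDegree_add_C_mul_le (p q : k[X]) (c : k) :
    (p + C c * q).natDegree ≤ max p.natDegree q.natDegree :=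
  (natDegree_add_le _ _).trans (max_le_max le_rfl (natDegree_C_mul_le _ _))

variable [IsAlgClosed k]

theorem isSquare_C_of_isAlgClosed (c : k) : IsSquare (C c : k[X]) := by
  obtain ⟨e, rfl⟩ := IsAlgClosed.exists_pow_nat_eq c two_pos
  exact ⟨C e, by rw [← C_mul, pow_two]⟩

theorem isSquare_of_associated_sq {a d : k[X]} (h : Associated (d ^ 2) a) : IsSquare a := by
  obtain ⟨u, rfl⟩ := h
  obtain ⟨c, -, hc⟩ := isUnit_iff.mp u.isUnit
  rw [← hc]
  exact (IsSquare.sq d).mul (isSquare_C_of_isAlgClosed c)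

theorem isSquare_of_isCoprime_mul {a b : k[X]} (hab : IsCoprime a b) (h : IsSquare (a * b)) :
    IsSquare a := by
  obtain ⟨c, hc⟩ := h
  obtain ⟨d, hd⟩ := exists_associated_pow_of_mul_eq_pow' hab (k := 2) (hc.trans (pow_two c).symm)
  exact isSquare_of_associated_sq hd

/-- A pencil of polynomials with four square members is constant. -/
theorem natDegree_eq_zero_of_four_squares (h2 : (2 : k) ≠ 0) {p q : k[X]} (hpq : IsCoprime p q)
    {a b : k} (ha : a ≠ 0) (hb : b ≠ 0) (hab : a ≠ b) (hp : IsSquare p) (hq : IsSquare q)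
    (hpa : IsSquare (p - C a * q)) (hpb : IsSquare (p - C b * q)) :
    p.natDegree = 0 ∧ q.natDegree = 0 := by
  -- Descent on the degree. With p = u², q = v², a = l², b = m², coprimality makes u ± l v and u ± m
  -- v squares. They lie in the pencil of u - l v and u + l v, of at most half the degree.
  induction hN : max p.natDegree q.natDegree using Nat.strong_induction_on generalizing p q a b with
  | _ N ih =>
  rcases Nat.eq_zero_or_pos N with h0 | h0
  · omega
  obtain ⟨u, rfl⟩ := hp
  obtain ⟨v, rfl⟩ := hq
  obtain ⟨l, rfl⟩ := IsAlgClosed.exists_pow_nat_eq a two_pos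
  obtain ⟨m, rfl⟩ := IsAlgClosed.exists_pow_nat_eq b two_pos
  have hl : l ≠ 0 := by rintro rfl; simp at ha
  have hm : m ≠ 0 := by rintro rfl; simp at hb
  have hml : m - l ≠ 0 := fun h => hab (by rw [sub_eq_zero.mp h])
  have hml' : m + l ≠ 0 := fun h => hab (by rw [eq_neg_of_add_eq_zero_left h]; ring)
  have huv : IsCoprime u v := IsCoprime.of_mul_left_left (IsCoprime.of_mul_right_left hpq)
  have key : ∀ {n : k}, n ≠ 0 → IsSquare (u * u - C (n ^ 2) * (v * v)) →
      IsSquare (u + C n * v) := by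
    intro n hn hs
    have hc : IsCoprime (u + C n * v) (u + C (-n) * v) := by
      have := isCoprime_linear_combinations huv (a := 1) (b := n) (c := 1) (d := -n)
        (by rw [show 1 * -n - n * 1 = -(2 * n) by ring]; exact neg_ne_zero.mpr (mul_ne_zero h2 hn))
      simpa using this
    refine isSquare_of_isCoprime_mul hc ?_
    convert hs using 1
    rw [C_neg, C_pow]
    ring
  have s1 := key hl hpa
  have s2 := key (neg_ne_zero.mpr hl) (by rwa [neg_sq])
  have s3 := key hm hpb
  have s4 := key (neg_ne_zero.mpr hm) (by rwa [neg_sq])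
  have hc : IsCoprime (u + C (-l) * v) (u + C l * v) := by
    have := isCoprime_linear_combinations huv (a := 1) (b := -l) (c := 1) (d := l)
      (by rw [show 1 * l - -l * 1 = 2 * l by ring]; exact mul_ne_zero h2 hl)
    simpa using this
  have d1 := natDegree_add_C_mul_le u v (-l)
  have d2 := natDegree_add_C_mul_le u v l
  have e1 : u.natDegree ≤ (u * u).natDegree / 2 := by
    rw [← pow_two, natDegree_pow]; omega
  have e2 : v.natDegree ≤ (v * v).natDegree / 2 := by
    rw [← pow_two, natDegree_pow]; omega
  -- Up to constants, u - m v and u + m v are the members of the new pencil with parameters (m - l)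
  -- / (m + l) and (m + l) / (m - l).
  have i1 : IsSquare (u + C (-l) * v - C ((m - l) / (m + l)) * (u + C l * v)) := by
    have e : C ((m - l) / (m + l)) = 1 - C (2 * l / (m + l)) := by
      rw [← C_1, ← C_sub]; congr 1; field_simp; ring
    have e' : C (2 * l / (m + l)) * (C m + C l) = 2 * C l := by
      rw [← C_add, ← C_mul, div_mul_cancel₀ _ hml', C_mul, C_ofNat]
    rw [e, show u + C (-l) * v - (1 - C (2 * l / (m + l))) * (u + C l * v)
      = C (2 * l / (m + l)) * (u + C (-m) * v) by
        rw [C_neg, C_neg]; linear_combination v * e']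
    exact (isSquare_C_of_isAlgClosed _).mul s4
  have i2 : IsSquare (u + C (-l) * v - C ((m + l) / (m - l)) * (u + C l * v)) := by
    have e : C ((m + l) / (m - l)) = 1 + C (2 * l / (m - l)) := by
      rw [← C_1, ← C_add]; congr 1; field_simp; ring
    have e' : C (2 * l / (m - l)) * (C m - C l) = 2 * C l := by
      rw [← C_sub, ← C_mul, div_mul_cancel₀ _ hml, C_mul, C_ofNat]
    rw [e, show u + C (-l) * v - (1 + C (2 * l / (m - l))) * (u + C l * v)
      = C (-(2 * l / (m - l))) * (u + C m * v) by
        rw [C_neg, C_neg]; linear_combination v * e']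
    exact (isSquare_C_of_isAlgClosed _).mul s3
  obtain ⟨z1, z2⟩ := ih _ (by omega) hc (div_ne_zero hml hml') (div_ne_zero hml' hml)
    (by
      rw [Ne, div_eq_div_iff hml' hml]
      intro h
      have : (2 * 2) * (m * l) = 0 := by linear_combination -h
      exact mul_ne_zero (mul_ne_zero h2 h2) (mul_ne_zero hm hl) this) s2 s1 i1 i2 rfl
  obtain ⟨c, hc1⟩ := natDegree_eq_zero.mp z1
  obtain ⟨d, hd1⟩ := natDegree_eq_zero.mp z2
  have hu : u = C ((c + d) / 2) := by
    have h2C : (C 2 : k[X]) ≠ 0 := C_ne_zero.mpr h2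
    apply mul_left_cancel₀ h2C
    rw [← C_mul, mul_div_cancel₀ _ h2, C_add, hc1, hd1, C_neg, C_ofNat]
    ring
  have hv : v = C ((d - c) / (2 * l)) := by
    have h2C : (C (2 * l) : k[X]) ≠ 0 := C_ne_zero.mpr (mul_ne_zero h2 hl)
    apply mul_left_cancel₀ h2C
    rw [← C_mul, mul_div_cancel₀ _ (mul_ne_zero h2 hl), C_sub, hc1, hd1, C_neg, C_mul, C_ofNat]
    ring
  rw [hu, hv, ← C_mul, ← C_mul]
  exact ⟨natDegree_C _, natDegree_C _⟩

/-- The discriminant of x³ - A x + A is A² (4A - 27). -/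
theorem exists_distinct_roots (h2 : (2 : k) ≠ 0) {A : k} (hA : A ≠ 0) (hA' : 4 * A ≠ 27) :
    ∃ e₁ e₂ e₃ : k, e₁ ≠ e₂ ∧ e₁ ≠ e₃ ∧ e₂ ≠ e₃ ∧ e₁ + e₂ + e₃ = 0 ∧
      e₁ * e₂ + e₁ * e₃ + e₂ * e₃ = -A ∧ e₁ * e₂ * e₃ = -A := by
  obtain ⟨e, he⟩ := IsAlgClosed.exists_root (X ^ 3 + C (-A) * X + C A) (by
    rw [show (X ^ 3 + C (-A) * X + C A : k[X]) = C 1 * X ^ 3 + C 0 * X ^ 2 + C (-A) * X + C A by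
      simp, degree_cubic one_ne_zero]
    norm_num)
  -- 4A - 3e² is the discriminant of the cofactor x² + e x + e² - A of x - e.
  obtain ⟨d, hd⟩ := IsAlgClosed.exists_pow_nat_eq (4 * A - 3 * e ^ 2) two_pos
  simp at he
  obtain ⟨f, hf⟩ : ∃ f, 2 * f = -e + d := ⟨(-e + d) / 2, mul_div_cancel₀ _ h2⟩
  obtain rfl : d = 2 * f + e := by linear_combination -hf
  have h4 : (4 : k) ≠ 0 := by
    rw [show (4 : k) = 2 * 2 by norm_num]; exact mul_ne_zero h2 h2
  have hq : e ^ 2 + e * f + f ^ 2 = A := by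
    apply mul_left_cancel₀ h4
    linear_combination hd
  have hc : e * f * (e + f) = A := by linear_combination e * hq - he
  have hdisc : ((e - f) * (e - (-e - f)) * (f - (-e - f))) ^ 2 ≠ 0 := by
    have : ((e - f) * (e - (-e - f)) * (f - (-e - f))) ^ 2 = A ^ 2 * (4 * A - 27) := by
      rw [show A ^ 2 * (4 * A - 27) = 4 * A ^ 3 - 27 * A ^ 2 by ring]
      nth_rw 1 [← hq]
      rw [← hc]
      ring
    rw [this]
    exact mul_ne_zero (pow_ne_zero 2 hA) (sub_ne_zero.mpr hA')
  rw [pow_ne_zero_iff two_ne_zero, mul_ne_zero_iff, mul_ne_zero_iff, sub_ne_zero, sub_ne_zero,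
    sub_ne_zero] at hdisc
  refine ⟨e, f, -e - f, hdisc.1.1, hdisc.1.2, hdisc.2, by ring, ?_, ?_⟩
  · linear_combination -hq
  · linear_combination -hc

/-- The equation puts (p / q, r / s) on y² = x³ - A x + A. Comparison of denominators makes q³ and
s² associated, so q is a square. The factors p - eᵢ q are pairwise coprime with square product, so
they are squares too: four square members in one pencil. -/
theorem natDegree_eq_zero_of_cubic (h2 : (2 : k) ≠ 0) {A : k} (hA : A ≠ 0) (hA' : 4 * A ≠ 27)
    {p q r s : k[X]} (hpq : IsCoprime p q) (hrs : IsCoprime r s) (hq : q ≠ 0)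
    (h : r ^ 2 * q ^ 3 = s ^ 2 * (p ^ 3 - C A * p * q ^ 2 + C A * q ^ 3)) :
    (p.natDegree = 0 ∧ q.natDegree = 0) ∧ r.natDegree = 0 ∧ s.natDegree = 0 := by
  obtain ⟨e₁, e₂, e₃, h12, h13, h23, hs1, hs2, hs3⟩ := exists_distinct_roots h2 hA hA'
  have hN : p ^ 3 - C A * p * q ^ 2 + C A * q ^ 3
      = (p - C e₁ * q) * ((p - C e₂ * q) * (p - C e₃ * q)) := by
    have t1 := congrArg (C : k → k[X]) hs1
    have t2 := congrArg (C : k → k[X]) hs2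
    have t3 := congrArg (C : k → k[X]) hs3
    simp only [C_add, C_mul, C_neg, C_0] at t1 t2 t3
    linear_combination p ^ 2 * q * t1 - p * q ^ 2 * t2 + q ^ 3 * t3
  rw [hN] at h
  have hcop : ∀ {e f : k}, e ≠ f → IsCoprime (p - C e * q) (p - C f * q) := by
    intro e f hef
    have := isCoprime_linear_combinations hpq (a := 1) (b := -e) (c := 1) (d := -f)
      (by rw [show 1 * -f - -e * 1 = e - f by ring]; exact sub_ne_zero.mpr hef)
    simpa [sub_eq_add_neg] using this
  have hcopq : ∀ e : k, IsCoprime (p - C e * q) q := by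
    intro e
    have := isCoprime_linear_combinations hpq (a := 1) (b := -e) (c := 0) (d := 1) (by simp)
    simpa [sub_eq_add_neg] using this
  have hd1 : q ^ 3 ∣ s ^ 2 := by
    have hc : IsCoprime (q ^ 3) ((p - C e₁ * q) * ((p - C e₂ * q) * (p - C e₃ * q))) :=
      ((hcopq e₁).mul_left ((hcopq e₂).mul_left (hcopq e₃))).symm.pow_left
    refine hc.dvd_of_dvd_mul_right ?_
    rw [← h]
    exact dvd_mul_left _ _
  have hd2 : s ^ 2 ∣ q ^ 3 := by
    have hc : IsCoprime (s ^ 2) (r ^ 2) := hrs.symm.pow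
    refine hc.dvd_of_dvd_mul_left ?_
    rw [h]
    exact dvd_mul_right _ _
  obtain ⟨c, hc⟩ := associated_of_dvd_dvd hd1 hd2
  obtain ⟨m, rfl⟩ : q ∣ s := by
    rw [← IsIntegrallyClosed.pow_dvd_pow_iff two_ne_zero]
    exact (pow_dvd_pow q (by norm_num)).trans hd1
  have hqs : q * c = m ^ 2 := by
    apply mul_left_cancel₀ (pow_ne_zero 2 hq)
    linear_combination hc
  have hrN : r ^ 2 = c * ((p - C e₁ * q) * ((p - C e₂ * q) * (p - C e₃ * q))) := by
    apply mul_right_cancel₀ (pow_ne_zero 3 hq)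
    rw [h, ← hc]; ring
  have hNs : IsSquare ((p - C e₁ * q) * ((p - C e₂ * q) * (p - C e₃ * q))) :=
    isSquare_of_associated_sq (d := r) (Associated.symm ⟨c, by rw [hrN, mul_comm]⟩)
  have s1 := isSquare_of_isCoprime_mul ((hcop h12).mul_right (hcop h13)) hNs
  have s2 := isSquare_of_isCoprime_mul (a := p - C e₂ * q)
    (b := (p - C e₁ * q) * (p - C e₃ * q)) ((hcop h12.symm).mul_right (hcop h23))
    (by convert hNs using 1; ring)
  have s3 := isSquare_of_isCoprime_mul (a := p - C e₃ * q)
    (b := (p - C e₁ * q) * (p - C e₂ * q)) ((hcop h13.symm).mul_right (hcop h23.symm))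
    (by convert hNs using 1; ring)
  have sq : IsSquare q := isSquare_of_associated_sq (d := m) (Associated.symm ⟨c, hqs⟩)
  obtain ⟨z1, z2⟩ := natDegree_eq_zero_of_four_squares h2 (hcopq e₁) (a := e₂ - e₁) (b := e₃ - e₁)
    (sub_ne_zero.mpr h12.symm) (sub_ne_zero.mpr h13.symm) (fun h => h23 (by linear_combination h))
    s1 sq (by convert s2 using 1; rw [C_sub]; ring) (by convert s3 using 1; rw [C_sub]; ring)
  have z3 : p.natDegree = 0 := by
    have := natDegree_add_C_mul_le (p - C e₁ * q) q e₁
    rw [sub_add_cancel] at this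
    omega
  have hz : ∀ e, (p - C e * q).natDegree = 0 := by
    intro e
    have := natDegree_add_C_mul_le p q (-e)
    rw [C_neg, neg_mul, ← sub_eq_add_neg] at this
    omega
  have hcd : (c : k[X]).natDegree = 0 := natDegree_eq_zero_of_isUnit c.isUnit
  refine ⟨⟨z3, z2⟩, ?_, ?_⟩
  · have d := congrArg natDegree hrN
    rw [natDegree_pow] at d
    have b1 := natDegree_mul_le (p := (c : k[X]))
      (q := (p - C e₁ * q) * ((p - C e₂ * q) * (p - C e₃ * q)))
    have b2 := natDegree_mul_le (p := p - C e₁ * q) (q := (p - C e₂ * q) * (p - C e₃ * q))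
    have b3 := natDegree_mul_le (p := p - C e₂ * q) (q := p - C e₃ * q)
    have := hz e₁
    have := hz e₂
    have := hz e₃
    omega
  · have d := congrArg natDegree hc
    rw [natDegree_pow (q * m)] at d
    have b1 := natDegree_mul_le (p := q ^ 3) (q := (c : k[X]))
    rw [natDegree_pow] at b1
    omega

end FourSquares

/-! ### Points of E over a rational function field -/

section Rational

variable {K L : Type*} [Field K] [Field L] [Algebra K L]

theorem exists_eq_mul_isCoprime (p : K[X]) {q : K[X]} (hq : q ≠ 0) :
    ∃ g p' q' : K[X], g ≠ 0 ∧ IsCoprime p' q' ∧ p = g * p' ∧ q = g * q' := by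
  classical
  obtain ⟨p', hp'⟩ := EuclideanDomain.gcd_dvd_left p q
  obtain ⟨q', hq'⟩ := EuclideanDomain.gcd_dvd_right p q
  have hb := EuclideanDomain.gcd_eq_gcd_ab p q
  set g := EuclideanDomain.gcd p q
  have hg : g ≠ 0 := by
    intro h
    rw [h, zero_mul] at hq'
    exact hq hq'
  refine ⟨g, p', q', hg, ?_, hp', hq'⟩
  refine ⟨EuclideanDomain.gcdA p q, EuclideanDomain.gcdB p q, mul_left_cancel₀ hg ?_⟩
  linear_combination -hb - EuclideanDomain.gcdA p q * hp' - EuclideanDomain.gcdB p q * hq'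

theorem exists_coprime_fraction {y a : L} (hy : Transcendental K y)
    (ha : a ∈ IntermediateField.adjoin K {y}) :
    ∃ p q : K[X], IsCoprime p q ∧ q ≠ 0 ∧ a = aeval y p / aeval y q := by
  rw [IntermediateField.mem_adjoin_simple_iff] at ha
  obtain ⟨p, q, rfl⟩ := ha
  by_cases hq : q = 0
  · exact ⟨0, 1, isCoprime_one_right, one_ne_zero, by simp [hq]⟩
  obtain ⟨g, p', q', hg, hc, rfl, rfl⟩ := exists_eq_mul_isCoprime p hq
  refine ⟨p', q', hc, right_ne_zero_of_mul hq, ?_⟩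
  have hg' : aeval y g ≠ 0 := by
    rwa [Ne, map_eq_zero_iff _ (QuadraticCover.aeval_injective hy)]
  rw [map_mul, map_mul, mul_div_mul_left _ _ hg']

/-- A point of the curve `y² = x³ - A x + A` over a purely transcendental extension of `K` of
degree one is constant. -/
theorem mem_range_of_rational (h2 : (2 : K) ≠ 0) {A : K} (hA : A ≠ 0) (hA' : 4 * A ≠ 27)
    {y a b : L} (hy : Transcendental K y) (ha : a ∈ IntermediateField.adjoin K {y})
    (hb : b ∈ IntermediateField.adjoin K {y})
    (h : b ^ 2 = a ^ 3 - algebraMap K L A * a + algebraMap K L A) :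
    (∃ c : K, a = algebraMap K L c) ∧ ∃ d : K, b = algebraMap K L d := by
  obtain ⟨p, q, hpq, hq, rfl⟩ := exists_coprime_fraction hy ha
  obtain ⟨r, s, hrs, hs, rfl⟩ := exists_coprime_fraction hy hb
  have hinj := QuadraticCover.aeval_injective hy
  have hq' : aeval y q ≠ 0 := by rwa [Ne, map_eq_zero_iff _ hinj]
  have hs' : aeval y s ≠ 0 := by rwa [Ne, map_eq_zero_iff _ hinj]
  have key : r ^ 2 * q ^ 3 = s ^ 2 * (p ^ 3 - C A * p * q ^ 2 + C A * q ^ 3) := by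
    apply hinj
    field_simp at h
    simp only [map_mul, map_add, map_sub, map_pow, aeval_C]
    apply mul_right_cancel₀ hq'
    linear_combination (aeval y q) * h
  -- The descent needs an algebraically closed field; extending scalars preserves coprimality and
  -- degrees.
  let j := algebraMap K (AlgebraicClosure K)
  have hj : Function.Injective j := j.injective
  have key' := congrArg (Polynomial.map j) key
  simp only [Polynomial.map_mul, Polynomial.map_add, Polynomial.map_sub, Polynomial.map_pow,
    Polynomial.map_C] at key'
  obtain ⟨⟨z1, z2⟩, z3, z4⟩ := natDegree_eq_zero_of_cubic
    (by simpa [j, map_ofNat] using hj.ne h2) (by simpa [j] using hj.ne hA)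
    (by simpa [j, map_ofNat] using hj.ne hA') (hpq.map (mapRingHom j)) (hrs.map (mapRingHom j))
    (by simpa [j] using hq) key'
  simp only [coe_mapRingHom, natDegree_map] at z1 z2 z3 z4
  obtain ⟨p, rfl⟩ := natDegree_eq_zero.mp z1
  obtain ⟨q, rfl⟩ := natDegree_eq_zero.mp z2
  obtain ⟨r, rfl⟩ := natDegree_eq_zero.mp z3
  obtain ⟨s, rfl⟩ := natDegree_eq_zero.mp z4
  exact ⟨⟨p / q, by simp⟩, ⟨r / s, by simp⟩⟩

end Rational

/-! ### Independence of the two maps -/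

section Conjugates

variable {K : Type*} [Field K] {B : K} {D : QuadraticCover K}

theorem QuadraticCover.y_sq_quartic (hD : D.f = X ^ 4 + X ^ 3 + C B) :
    D.y ^ 2 = D.x ^ 4 + D.x ^ 3 + algebraMap K _ B := by
  have h := D.y_sq.trans (congrArg (aeval D.x) hD)
  simpa using h

theorem QuadraticCover.transcendental_y (hD : D.f = X ^ 4 + X ^ 3 + C B) :
    Transcendental K D.y :=
  transcendental_of_quartic' (y_sq_quartic hD) D.transcendental_x

/-- Over K(y), x is a root of T⁴ + T³ + (B - y²), which is separable: y² is transcendental, so B -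
y² is neither 0 nor 27/256. -/
theorem QuadraticCover.isSeparable_adjoin_y (h2 : (2 : K) ≠ 0)
    (hD : D.f = X ^ 4 + X ^ 3 + C B) :
    Algebra.IsSeparable (IntermediateField.adjoin K {D.y}) D.FunctionField := by
  set M := IntermediateField.adjoin K {D.y} with hM
  have hyM : D.y ∈ M := IntermediateField.mem_adjoin_simple_self K D.y
  let b : M := algebraMap K M B - ⟨D.y, hyM⟩ ^ 2
  have hb : (b : D.FunctionField) = algebraMap K _ B - D.y ^ 2 := rfl
  have htr := QuadraticCover.transcendental_y hD
  have htr2 : Transcendental K (D.y ^ 2) := htr.pow two_pos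
  have hb0 : b ≠ 0 := by
    intro h
    have h' : algebraMap K _ B - D.y ^ 2 = 0 := by rw [← hb, h]; rfl
    exact htr2.ne_algebraMap B (by linear_combination -h')
  have hb1 : 256 * b ≠ 27 := by
    intro h
    have h' : 256 * (algebraMap K _ B - D.y ^ 2) = 27 := by
      rw [← hb, ← show ((256 * b : M) : D.FunctionField) = 256 * (b : D.FunctionField) from rfl, h]
      rfl
    have h256 : (256 : K) ≠ 0 := by
      rw [show (256 : K) = 2 ^ 8 by norm_num]; exact pow_ne_zero 8 h2
    have h256' : (256 : D.FunctionField) ≠ 0 := by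
      simpa [map_ofNat] using (algebraMap K D.FunctionField).injective.ne h256
    refine htr2.ne_algebraMap (B - 27 / 256) (mul_left_cancel₀ h256' ?_)
    simp only [map_sub, map_div₀, map_ofNat]
    rw [mul_sub, mul_div_cancel₀ _ h256']
    linear_combination -h'
  have hx : IsSeparable M D.x := by
    refine (separable_quartic hb0 hb1).of_dvd (minpoly.dvd M D.x ?_)
    have := QuadraticCover.y_sq_quartic hD
    simp only [map_add, map_pow, aeval_X, aeval_C, IntermediateField.algebraMap_apply, hb]
    linear_combination -this
  rw [← separableClosure.eq_top_iff, eq_top_iff]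
  intro a _
  have ha : a ∈ IntermediateField.adjoin K {D.x, D.y} :=
    D.adjoin_eq_top ▸ IntermediateField.mem_top
  have hle : IntermediateField.adjoin K {D.x, D.y}
      ≤ (separableClosure M D.FunctionField).restrictScalars K := by
    rw [IntermediateField.adjoin_le_iff]
    rintro _ (rfl | rfl)
    · exact mem_separableClosure_iff.mpr hx
    · exact algebraMap_mem (separableClosure M D.FunctionField) (⟨_, hyM⟩ : M)
  exact hle ha

/-- A function on the curve `y² = x⁴ + x³ + B` with the same value at all points of a fibre of
`y` is a function of `y`. -/
theorem QuadraticCover.mem_adjoin_y (h2 : (2 : K) ≠ 0) (hD : D.f = X ^ 4 + X ^ 3 + C B)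
    {h : D.FunctionField}
    (hh : ∀ φ : D.FunctionField →ₐ[K] AlgebraicClosure D.FunctionField,
      φ D.y = algebraMap _ _ D.y → φ h = algebraMap _ _ h) :
    h ∈ IntermediateField.adjoin K {D.y} := by
  have := QuadraticCover.isSeparable_adjoin_y h2 hD
  set M := IntermediateField.adjoin K {D.y} with hM
  have hyM : D.y ∈ M := IntermediateField.mem_adjoin_simple_self K D.y
  have hs := Algebra.IsSeparable.isSeparable M h
  -- The roots of the minimal polynomial are the conjugates of h over K(y). There is only one, so by
  -- separability the degree is 1.
  have hroots : (minpoly M h).rootSet (AlgebraicClosure D.FunctionField)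
      = {algebraMap _ _ h} := by
    rw [← Algebra.IsAlgebraic.range_eval_eq_rootSet_minpoly]
    ext a
    constructor
    · rintro ⟨φ, rfl⟩
      exact hh (φ.restrictScalars K) (φ.commutes ⟨D.y, hyM⟩)
    · rintro rfl
      exact ⟨IsScalarTower.toAlgHom M D.FunctionField _, rfl⟩
  have hdeg : (minpoly M h).natDegree = 1 := by
    rw [← card_rootSet_eq_natDegree (K := AlgebraicClosure D.FunctionField) hs
      (IsAlgClosed.splits _)]
    simp [hroots]
  obtain ⟨m, hm⟩ := minpoly.natDegree_eq_one_iff.mp hdeg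
  rw [← hm]
  exact m.2

end Conjugates

/-! ### Cancelling one map by points of H with the same image in D -/

section Independence

open WeierstrassCurve.Affine

variable {K : Type*} [Field K] {A : K} {H D : QuadraticCover K}

theorem cubic_of_quartic {F : Type*} [Field F] {a c : F} (hac : a ≠ c)
    (h : a ^ 4 + a ^ 3 = c ^ 4 + c ^ 3) :
    (a ^ 3 + a ^ 2 * c + a * c ^ 2 + c ^ 3) + (a ^ 2 + a * c + c ^ 2) = 0 := by
  apply mul_left_cancel₀ (sub_ne_zero.mpr hac)
  linear_combination h

/-- The quadratic is the cofactor of (T - a)(T - c) in T⁴ + T³ - (a⁴ + a³), and b is any root of it;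
b may equal a or c. -/
theorem exists_common_neighbour {F : Type*} [Field F] [IsAlgClosed F] {a c : F} (hac : a ≠ c)
    (h : a ^ 4 + a ^ 3 = c ^ 4 + c ^ 3) :
    ∃ b : F, (a ^ 3 + a ^ 2 * b + a * b ^ 2 + b ^ 3) + (a ^ 2 + a * b + b ^ 2) = 0 ∧
      (c ^ 3 + c ^ 2 * b + c * b ^ 2 + b ^ 3) + (c ^ 2 + c * b + b ^ 2) = 0 := by
  have h1 := cubic_of_quartic hac h
  obtain ⟨b, hb⟩ := IsAlgClosed.exists_root
    (C 1 * X ^ 2 + C (a + c + 1) * X + C (a ^ 2 + a * c + c ^ 2 + a + c)) (by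
      rw [degree_quadratic one_ne_zero]; norm_num)
  simp at hb
  exact ⟨b, by linear_combination (b - c) * hb + h1, by linear_combination (b - a) * hb + h1⟩

/-- The embeddings φ and χ are points of D with the same y. A common neighbour b of their
x-coordinates gives points θ and θ' of H lying over them under the first map and with the same image
under the second. Evaluated at θ and θ', the relation has equal terms in β and c, which cancel. -/
theorem map_eq_map_of_add_const [DecidableEq K] [DecidableEq D.FunctionField]
    [DecidableEq H.FunctionField] (h2 : (2 : K) ≠ 0) (hH : H.f = hyperellipticPoly A)
    (hD : D.f = X ^ 4 + X ^ 3 + C (A / 2 ^ 6)) (E : WeierstrassCurve.Affine K)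
    {p₁ p₂ : D.FunctionField →ₐ[K] H.FunctionField}
    (h1x : p₁ D.x = H.spaceX) (h1y : p₁ D.y = H.spaceY)
    (h2x : p₂ D.x = H.spaceZ) (h2y : p₂ D.y = H.spaceY)
    {α β : (E.baseChange D.FunctionField).Point} {c : (E.baseChange K).Point}
    (h : Point.map (W' := E) p₁ α + Point.map (W' := E) p₂ β
      = Point.map (W' := E) (Algebra.ofId K H.FunctionField) c)
    {Ω : Type*} [Field Ω] [DecidableEq Ω] [Algebra K Ω] [IsAlgClosed Ω] (φ χ : D.FunctionField →ₐ[K] Ω)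
    (hφχ : φ D.y = χ D.y) : Point.map (W' := E) φ α = Point.map (W' := E) χ α := by
  by_cases hx : φ D.x = χ D.x
  · rw [D.algHom_ext hx hφχ]
  have hquart : ∀ η : D.FunctionField →ₐ[K] Ω,
      η D.y ^ 2 = η D.x ^ 4 + η D.x ^ 3 + algebraMap K Ω (A / 2 ^ 6) := by
    intro η
    rw [← map_pow, QuadraticCover.y_sq_quartic hD, map_add, map_add, map_pow, map_pow,
      AlgHom.commutes]
  have hw : Transcendental K (φ D.y) :=
    QuadraticCover.transcendental_of_quartic' (hquart φ) (by
      intro h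
      exact D.transcendental_x ((isAlgebraic_algHom_iff φ φ.toRingHom.injective).mp h))
  obtain ⟨b, hb1, hb2⟩ := exists_common_neighbour hx (by
    have e1 := hquart φ
    have e2 := hquart χ
    rw [← hφχ] at e2
    linear_combination e2 - e1)
  obtain ⟨θ, tx, tz, ty⟩ := QuadraticCover.exists_embedding h2 hH hw (hquart φ) hb1
  obtain ⟨θ', tx', tz', ty'⟩ := QuadraticCover.exists_embedding h2 hH hw
    (by rw [hφχ]; exact hquart χ) hb2
  have e1 : θ.comp p₁ = φ := D.algHom_ext (by simp [h1x, tx]) (by simp [h1y, ty])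
  have e2 : θ'.comp p₁ = χ := D.algHom_ext (by simp [h1x, tx']) (by simp [h1y, ty', hφχ])
  have e3 : θ.comp p₂ = θ'.comp p₂ :=
    D.algHom_ext (by simp [h2x, tz, tz']) (by simp [h2y, ty, ty'])
  have k1 := congrArg (Point.map (W' := E) θ) h
  have k2 := congrArg (Point.map (W' := E) θ') h
  rw [map_add, Point.map_map, Point.map_map, Point.map_map, e1] at k1
  rw [map_add, Point.map_map, Point.map_map, Point.map_map, e2, ← e3] at k2
  -- A constant point has the same image under every K-embedding.
  have e4 : θ.comp (Algebra.ofId K H.FunctionField) = θ'.comp (Algebra.ofId K H.FunctionField) :=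
    Subsingleton.elim _ _
  rw [e4, ← k2] at k1
  exact add_right_cancel k1

/-- The coordinates of α have a single conjugate over K(y), hence lie in K(y), and points over K(y)
are constant. -/
theorem exists_const_of_map_eq [DecidableEq K] [DecidableEq D.FunctionField]
    [DecidableEq (AlgebraicClosure D.FunctionField)] (h2 : (2 : K) ≠ 0) (hA : A ≠ 0) (hA' : 4 * A ≠ 27)
    (hD : D.f = X ^ 4 + X ^ 3 + C (A / 2 ^ 6)) {E : WeierstrassCurve K}
    (hE : E = ⟨0, 0, 0, -A, A⟩) {α : (E.toAffine.baseChange D.FunctionField).Point}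
    (h : ∀ φ χ : D.FunctionField →ₐ[K] AlgebraicClosure D.FunctionField, φ D.y = χ D.y →
      Point.map (W' := E.toAffine) φ α = Point.map (W' := E.toAffine) χ α) :
    ∃ a : (E.toAffine.baseChange K).Point,
      α = Point.map (W' := E.toAffine) (Algebra.ofId K D.FunctionField) a := by
  rcases α with _ | ⟨a, b, hab⟩
  · exact ⟨0, rfl⟩
  have hmem : a ∈ IntermediateField.adjoin K {D.y} ∧ b ∈ IntermediateField.adjoin K {D.y} := by
    have key : ∀ φ : D.FunctionField →ₐ[K] AlgebraicClosure D.FunctionField,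
        φ D.y = algebraMap _ _ D.y → φ a = algebraMap _ _ a ∧ φ b = algebraMap _ _ b := by
      intro φ hφ
      have := h φ (IsScalarTower.toAlgHom K D.FunctionField _) hφ
      rw [Point.map_some, Point.map_some, Point.some.injEq] at this
      exact this
    exact ⟨QuadraticCover.mem_adjoin_y h2 hD fun φ hφ => (key φ hφ).1,
      QuadraticCover.mem_adjoin_y h2 hD fun φ hφ => (key φ hφ).2⟩
  have heq := (equation_iff ..).mp hab.1
  subst hE
  simp [WeierstrassCurve.Affine.baseChange, WeierstrassCurve.baseChange,
    WeierstrassCurve.toAffine] at heq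
  obtain ⟨⟨c, rfl⟩, d, rfl⟩ := mem_range_of_rational h2 hA hA' (QuadraticCover.transcendental_y hD)
    hmem.1 hmem.2 (by linear_combination heq)
  have hcd := (baseChange_nonsingular (W := (⟨0, 0, 0, -A, A⟩ : WeierstrassCurve K).toAffine)
    (f := Algebra.ofId K D.FunctionField) (Algebra.ofId K D.FunctionField).toRingHom.injective
    c d).mp hab
  exact ⟨.some c d hcd, rfl⟩

theorem map_map_ofId {F G : Type*} [Field F] [Algebra K F] [Field G] [Algebra K G] [DecidableEq K]
    [DecidableEq F] [DecidableEq G] (E : WeierstrassCurve.Affine K) (φ : G →ₐ[K] F)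
    (a : (E.baseChange K).Point) :
    Point.map (W' := E) φ (Point.map (W' := E) (Algebra.ofId K G) a)
      = Point.map (W' := E) (Algebra.ofId K F) a := by
  rw [Point.map_map, Subsingleton.elim (φ.comp (Algebra.ofId K G)) (Algebra.ofId K F)]

/-- The cancellation argument is needed for α only: once α is constant so is β ∘ g₂, and points
inject under field embeddings. -/
theorem independentMaps (h2 : (2 : K) ≠ 0) (hA : A ≠ 0) (hA' : 4 * A ≠ 27)
    (hH : H.f = hyperellipticPoly A) (hD : D.f = X ^ 4 + X ^ 3 + C (A / 2 ^ 6))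
    {E : WeierstrassCurve K} (hE : E = ⟨0, 0, 0, -A, A⟩)
    {f₁ f₂ : CurveMap K H.FunctionField D.FunctionField}
    (h1x : f₁.pullback D.x = H.spaceX) (h1y : f₁.pullback D.y = H.spaceY)
    (h2x : f₂.pullback D.x = H.spaceZ) (h2y : f₂.pullback D.y = H.spaceY)
    (ψ : CurveMap K D.FunctionField E.toAffine.FunctionField) :
    IndependentMaps E.toAffine (ψ.comp f₁) (ψ.comp f₂) := by
  intro α β ⟨c, hc⟩
  -- The group law takes decidable equality as an argument; these are the classical instances used
  -- in `IndependentMaps`.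
  let _ : DecidableEq K := fun a b => Classical.propDecidable (a = b)
  let _ : DecidableEq H.FunctionField := fun a b => Classical.propDecidable (a = b)
  let _ : DecidableEq D.FunctionField := fun a b => Classical.propDecidable (a = b)
  let _ : DecidableEq E.toAffine.FunctionField := fun a b => Classical.propDecidable (a = b)
  let _ : DecidableEq (AlgebraicClosure D.FunctionField) :=
    fun a b => Classical.propDecidable (a = b)
  have hc' : Point.map (W' := E.toAffine) f₁.pullback (Point.map (W' := E.toAffine) ψ.pullback α)
      + Point.map (W' := E.toAffine) f₂.pullback (Point.map (W' := E.toAffine) ψ.pullback β)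
      = Point.map (W' := E.toAffine) (Algebra.ofId K H.FunctionField) c := by
    rw [Point.map_map, Point.map_map]
    exact hc
  obtain ⟨a, ha⟩ := exists_const_of_map_eq h2 hA hA' hD hE
    (map_eq_map_of_add_const h2 hH hD E.toAffine h1x h1y h2x h2y hc')
  have hb : Point.map (W' := E.toAffine) f₂.pullback (Point.map (W' := E.toAffine) ψ.pullback β)
      = Point.map (W' := E.toAffine) (Algebra.ofId K H.FunctionField) (c - a) := by
    rw [map_sub, ← hc', ha, map_map_ofId, add_sub_cancel_left]
  refine ⟨⟨a, Point.map_injective (W' := E.toAffine) ψ.pullback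
      (ha.trans (map_map_ofId _ ψ.pullback a).symm)⟩,
    ⟨c - a, Point.map_injective (W' := E.toAffine) ψ.pullback
      (Point.map_injective (W' := E.toAffine) f₂.pullback (hb.trans ?_))⟩⟩
  exact ((congrArg (Point.map (W' := E.toAffine) f₂.pullback)
    (map_map_ofId _ ψ.pullback (c - a))).trans (map_map_ofId _ f₂.pullback (c - a))).symm

end Independence

/-! ### The affine coordinate ring of `y² = f(x)` is a Dedekind domain -/

/-- After cancelling the gcd, n'² is coprime to q'², so it divides the squarefree f and n' is a
unit. -/
theorem dvd_of_sq_dvd_sq_mul_squarefree {K : Type*} [Field K] {n q f : K[X]} (hf : Squarefree f)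
    (h : n ^ 2 ∣ q ^ 2 * f) : n ∣ q := by
  by_cases hn : n = 0
  · subst hn
    rw [zero_pow two_ne_zero, zero_dvd_iff] at h
    rcases mul_eq_zero.mp h with h | h
    · rw [pow_eq_zero_iff two_ne_zero] at h
      rw [h]
    · exact absurd h hf.ne_zero
  obtain ⟨g, q', n', hg, hc, rfl, rfl⟩ := exists_eq_mul_isCoprime q hn
  have h1 : n' ^ 2 ∣ q' ^ 2 * f := by
    apply (mul_dvd_mul_iff_left (pow_ne_zero 2 hg)).mp
    rw [← mul_pow, ← mul_assoc, ← mul_pow]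
    exact h
  have hc2 : IsCoprime (n' ^ 2) (q' ^ 2) := hc.symm.pow
  have h2 : n' ^ 2 ∣ f := hc2.dvd_of_dvd_mul_left h1
  have h3 : IsUnit n' := hf n' (pow_two n' ▸ h2)
  exact mul_dvd_mul_left _ h3.dvd

theorem IntermediateField.adjoin_eq_top_of_pair {K k F : Type*} [Field K] [Field k] [Field F]
    [Algebra K k] [Algebra k F] [Algebra K F] [IsScalarTower K k F] {x y : F}
    (h : adjoin K {x, y} = ⊤) (hx : ∃ c, algebraMap k F c = x) : adjoin k {y} = ⊤ := by
  rw [eq_top_iff]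
  intro a _
  have ha : a ∈ adjoin K {x, y} := h ▸ mem_top
  have hle : adjoin K {x, y} ≤ (adjoin k {y}).restrictScalars K := by
    rw [adjoin_le_iff]
    rintro _ (rfl | rfl)
    · rw [SetLike.mem_coe, mem_restrictScalars]
      obtain ⟨c, rfl⟩ := hx
      exact (adjoin k {y}).algebraMap_mem c
    · rw [SetLike.mem_coe, mem_restrictScalars]
      exact mem_adjoin_simple_self _ _
  exact (mem_restrictScalars K).mp (hle ha)

namespace QuadraticCover

variable {K : Type*} [Field K] (H : QuadraticCover K)

noncomputable instance : Algebra (FractionRing K[X]) H.FunctionField :=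
  have : FaithfulSMul K[X] H.FunctionField := (faithfulSMul_iff_algebraMap_injective _ _).mpr
    fun p q h => aeval_injective H.transcendental_x (by simpa [algebraMap_polynomial] using h)
  FractionRing.liftAlgebra K[X] H.FunctionField

instance : FaithfulSMul K[X] H.FunctionField := (faithfulSMul_iff_algebraMap_injective _ _).mpr
    fun p q h => aeval_injective H.transcendental_x (by simpa [algebraMap_polynomial] using h)

instance : IsScalarTower K[X] (FractionRing K[X]) H.FunctionField :=
  FractionRing.isScalarTower_liftAlgebra K[X] H.FunctionField

instance : IsScalarTower K (FractionRing K[X]) H.FunctionField :=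
  IsScalarTower.to₁₃₄ K K[X] (FractionRing K[X]) H.FunctionField

theorem dvd_of_isIntegral {p n : K[X]} (hn : n ≠ 0)
    (h : IsIntegral K[X] (aeval H.x p / aeval H.x n)) : n ∣ p := by
  have h1 : aeval H.x p / aeval H.x n = algebraMap (FractionRing K[X]) H.FunctionField
      (algebraMap K[X] (FractionRing K[X]) p / algebraMap K[X] (FractionRing K[X]) n) := by
    rw [map_div₀, ← IsScalarTower.algebraMap_apply, ← IsScalarTower.algebraMap_apply,
      algebraMap_polynomial, algebraMap_polynomial]
  rw [h1, isIntegral_algebraMap_iff (algebraMap (FractionRing K[X]) H.FunctionField).injective] at h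
  obtain ⟨c, hc⟩ := IsIntegrallyClosed.isIntegral_iff.mp h
  have hn' : algebraMap K[X] (FractionRing K[X]) n ≠ 0 := by simpa using hn
  rw [eq_div_iff hn', ← map_mul] at hc
  exact ⟨c, by rw [mul_comm]; exact (IsFractionRing.injective K[X] (FractionRing K[X]) hc).symm⟩

/-- If (p + q y) / n is integral, so are its trace 2p / n and norm (p² - q² f) / n². As K[x] is
integrally closed, n divides p and n² divides q² f; f being squarefree, n divides q. -/
theorem mem_range_of_isIntegral (h2 : (2 : K) ≠ 0) {h : H.FunctionField} (hh : IsIntegral K[X] h) :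
    ∃ r : H.CoordinateRing, algebraMap _ _ r = h := by
  obtain ⟨p, q, n, hn, rfl⟩ := H.exists_eq_div h
  obtain ⟨φ, hx, hy⟩ := H.exists_conj
  have hφ : ∀ p : K[X], φ (aeval H.x p) = aeval H.x p := fun p => by
    rw [← aeval_algHom_apply, hx]
  let φ' : H.FunctionField →ₐ[K[X]] H.FunctionField :=
    { φ with commutes' := fun p => by rw [algebraMap_polynomial]; exact hφ p }
  have hh' := hh.map φ'
  have e : φ' ((aeval H.x p + aeval H.x q * H.y) / aeval H.x n)
      = (aeval H.x p - aeval H.x q * H.y) / aeval H.x n := by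
    change φ _ = _
    rw [map_div₀, map_add, map_mul, hφ, hφ, hφ, hy]
    ring
  rw [e] at hh'
  have hn' : aeval H.x n ≠ 0 := by
    rwa [Ne, map_eq_zero_iff _ (aeval_injective H.transcendental_x)]
  have hp : n ∣ p := by
    have h1 : n ∣ 2 * p := by
      apply H.dvd_of_isIntegral hn
      have h3 := hh.add hh'
      rw [← add_div, add_add_sub_cancel, ← two_mul] at h3
      rwa [map_mul, map_ofNat]
    have hu : IsUnit (2 : K[X]) := by
      rw [← C_ofNat]; exact isUnit_C.mpr (IsUnit.mk0 _ h2)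
    exact (hu.dvd_mul_left).mp h1
  have hq : n ∣ q := by
    have h1 : n ^ 2 ∣ p ^ 2 - q ^ 2 * H.f := by
      apply H.dvd_of_isIntegral (pow_ne_zero 2 hn)
      have h3 := hh.mul hh'
      rw [div_mul_div_comm, ← sq_sub_sq, mul_pow, H.y_sq, ← pow_two] at h3
      rwa [map_sub, map_mul, map_pow, map_pow, map_pow]
    apply dvd_of_sq_dvd_sq_mul_squarefree H.separable.squarefree
    have := dvd_sub (pow_dvd_pow_of_dvd hp 2) h1
    rwa [sub_sub_cancel] at this
  obtain ⟨p', rfl⟩ := hp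
  obtain ⟨q', rfl⟩ := hq
  refine ⟨AdjoinRoot.of _ p' + AdjoinRoot.of _ q' * AdjoinRoot.root _, ?_⟩
  rw [map_add, map_mul, algebraMap_of, algebraMap_of, ← QuadraticCover.y, map_mul, map_mul]
  field_simp

theorem isIntegral_y : IsIntegral K[X] H.y := by
  refine ⟨X ^ 2 - C H.f, monic_X_pow_sub_C _ two_ne_zero, ?_⟩
  rw [← aeval_def, map_sub, map_pow, aeval_X, aeval_C, algebraMap_polynomial, y_sq, sub_self]

theorem isIntegral_coordinateRing (r : H.CoordinateRing) :
    IsIntegral K[X] (algebraMap H.CoordinateRing H.FunctionField r) := by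
  obtain ⟨p, q, h⟩ := H.exists_coordinateRing r
  rw [h, ← algebraMap_polynomial, ← algebraMap_polynomial]
  exact isIntegral_algebraMap.add (isIntegral_algebraMap.mul H.isIntegral_y)

theorem isIntegralClosure (h2 : (2 : K) ≠ 0) :
    IsIntegralClosure H.CoordinateRing K[X] H.FunctionField where
  algebraMap_injective := IsFractionRing.injective _ _
  isIntegral_iff := ⟨H.mem_range_of_isIntegral h2, by
    rintro ⟨r, rfl⟩; exact H.isIntegral_coordinateRing r⟩

theorem adjoin_fractionRing_y : IntermediateField.adjoin (FractionRing K[X]) {H.y} = ⊤ := by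
  refine IntermediateField.adjoin_eq_top_of_pair H.adjoin_eq_top ⟨algebraMap K[X] _ X, ?_⟩
  rw [← IsScalarTower.algebraMap_apply, algebraMap_polynomial, aeval_X]

theorem finiteDimensional : FiniteDimensional (FractionRing K[X]) H.FunctionField := by
  have h1 : IsIntegral (FractionRing K[X]) H.y := H.isIntegral_y.tower_top
  have := IntermediateField.adjoin.finiteDimensional h1
  rw [H.adjoin_fractionRing_y] at this
  exact Module.Finite.equiv (IntermediateField.topEquiv
    (F := FractionRing K[X]) (E := H.FunctionField)).toLinearEquiv

theorem isSeparable (h2 : (2 : K) ≠ 0) :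
    Algebra.IsSeparable (FractionRing K[X]) H.FunctionField := by
  have h1 : IsSeparable (FractionRing K[X]) H.y := by
    have hs : (X ^ 2 - C (algebraMap K[X] (FractionRing K[X]) H.f)).Separable := by
      refine separable_X_pow_sub_C _ ?_ ?_
      · have := (algebraMap K (FractionRing K[X])).injective.ne h2
        simpa [map_ofNat] using this
      · simpa using H.separable.ne_zero
    refine hs.of_dvd (minpoly.dvd _ _ ?_)
    rw [map_sub, map_pow, aeval_X, aeval_C, ← IsScalarTower.algebraMap_apply,
      algebraMap_polynomial, y_sq, sub_self]
  rw [← separableClosure.eq_top_iff, eq_top_iff, ← H.adjoin_fractionRing_y,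
    IntermediateField.adjoin_le_iff]
  rintro _ rfl
  exact mem_separableClosure_iff.mpr h1

theorem isDedekindDomain (h2 : (2 : K) ≠ 0) : IsDedekindDomain H.CoordinateRing := by
  have := H.isIntegralClosure h2
  have := H.finiteDimensional
  have := H.isSeparable h2
  exact IsIntegralClosure.isDedekindDomain K[X] (FractionRing K[X]) H.FunctionField H.CoordinateRing

/-- The rational differentials are the multiples of `dx`. -/
theorem exists_kaehlerDifferential_equiv (h2 : (2 : K) ≠ 0) :
    ∃ e : (Ω[H.FunctionField⁄K]) ≃ₗ[H.FunctionField] H.FunctionField,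
      e (KaehlerDifferential.D K _ H.x) = 1 := by
  have := H.isSeparable h2
  -- K[x] → K(x) → K(H) is a localization followed by a separable extension, hence formally étale,
  -- so the differentials are the base change of the free module K[x] dx.
  have : Algebra.FormallyEtale (FractionRing K[X]) H.FunctionField :=
    Algebra.FormallyEtale.of_isSeparable _ _
  have : Algebra.FormallyEtale K[X] (FractionRing K[X]) :=
    Algebra.FormallyEtale.of_isLocalization (nonZeroDivisors K[X])
  have : Algebra.FormallyEtale K[X] H.FunctionField :=
    Algebra.FormallyEtale.comp K[X] (FractionRing K[X]) H.FunctionField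
  let e : (Ω[H.FunctionField⁄K]) ≃ₗ[H.FunctionField] H.FunctionField :=
    (KaehlerDifferential.tensorKaehlerEquivOfFormallyEtale K K[X] H.FunctionField).symm.trans
      (((KaehlerDifferential.polynomialEquiv K).baseChange K[X] H.FunctionField _ _).trans
        (TensorProduct.AlgebraTensorModule.rid K[X] H.FunctionField H.FunctionField))
  refine ⟨e, ?_⟩
  have hx : H.x = algebraMap K[X] H.FunctionField X := by rw [algebraMap_polynomial, aeval_X]
  simp only [e, LinearEquiv.trans_apply]
  rw [hx, KaehlerDifferential.tensorKaehlerEquivOfFormallyEtale_symm_D_algebraMap]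
  simp

end QuadraticCover

/-! ### Local rings and regular differentials -/

theorem Place.mem_of_sq_mem {K F : Type*} [Field K] [Field F] [Algebra K F] (P : Place K F) {a : F}
    (h : a ^ 2 ∈ P.ring) : a ∈ P.ring := by
  rcases P.ring.mem_or_inv_mem a with h1 | h1
  · exact h1
  · by_cases ha : a = 0
    · exact ha ▸ P.ring.zero_mem
    · have := P.ring.mul_mem _ _ h h1
      rwa [pow_two, mul_inv_cancel_right₀ ha] at this

theorem Place.aeval_mem {K F : Type*} [Field K] [Field F] [Algebra K F] (P : Place K F) {a : F}
    (h : a ∈ P.ring) (p : K[X]) : aeval a p ∈ P.ring := by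
  induction p using Polynomial.induction_on' with
  | add p q hp hq => rw [map_add]; exact P.ring.add_mem _ _ hp hq
  | monomial n c =>
    rw [aeval_monomial]
    exact P.ring.mul_mem _ _ (P.algebraMap_mem c) (pow_mem h n)

/-- A Dedekind domain inside a proper valuation subring of its field of fractions has that
valuation subring as a localization. -/
theorem ValuationSubring.exists_eq_div_of_isDedekindDomain {R F : Type*} [CommRing R]
    [IsDedekindDomain R] [Field F] [Algebra R F] [IsFractionRing R F] (V : ValuationSubring F)
    (hV : V ≠ ⊤) (hR : ∀ r : R, algebraMap R F r ∈ V) {b : F} (hb : b ∈ V) :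
    ∃ r s : R, algebraMap R F s ≠ 0 ∧ (algebraMap R F s)⁻¹ ∈ V ∧
      b = algebraMap R F r / algebraMap R F s := by
  let j : R →+* V := (algebraMap R F).codRestrict V.toSubring hR
  have hj : ∀ r, (j r : F) = algebraMap R F r := fun _ => rfl
  -- The centre of V on R: elements of R outside p are units of V, so p = 0 would force V = F.
  let p : Ideal R := (IsLocalRing.maximalIdeal V).comap j
  have hp : p.IsPrime := Ideal.comap_isPrime _ _
  have hunit : ∀ s : R, s ∉ p → algebraMap R F s ≠ 0 ∧ (algebraMap R F s)⁻¹ ∈ V := by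
    intro s hs
    have hu : IsUnit (j s) := by
      by_contra hu
      exact hs ((IsLocalRing.mem_maximalIdeal _).mpr hu)
    obtain ⟨u, hu⟩ := hu
    have h1 : ((u⁻¹ : Vˣ) : V) * j s = 1 := by rw [← hu, Units.inv_mul]
    have h2 : (((u⁻¹ : Vˣ) : V) : F) * algebraMap R F s = 1 := by
      rw [← hj]; exact congrArg Subtype.val h1
    refine ⟨right_ne_zero_of_mul_eq_one h2, ?_⟩
    rw [← eq_inv_of_mul_eq_one_left h2]
    exact ((u⁻¹ : Vˣ) : V).2
  have hp0 : p ≠ ⊥ := by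
    intro h0
    apply hV
    rw [_root_.eq_top_iff]
    intro a _
    obtain ⟨r, s, hs, rfl⟩ := IsFractionRing.div_surjective (A := R) a
    rw [div_eq_mul_inv]
    refine V.mul_mem _ _ (hR r) (hunit s ?_).2
    rw [h0, Ideal.mem_bot]
    exact nonZeroDivisors.ne_zero hs
  have := IsLocalization.AtPrime.isDiscreteValuationRing_of_dedekind_domain R hp0
    (Localization.AtPrime p)
  have hinj : Function.Injective (algebraMap R (Localization.AtPrime p)) :=
    IsLocalization.injective _ p.primeCompl_le_nonZeroDivisors
  have hdvd : ∀ a b : R, algebraMap R (Localization.AtPrime p) b ∣ algebraMap R _ a →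
      ∃ c s : R, s ∉ p ∧ a * s = b * c := by
    rintro a b ⟨z, hz⟩
    obtain ⟨⟨c, s⟩, hcs⟩ := IsLocalization.surj p.primeCompl z
    refine ⟨c, s, s.2, hinj ?_⟩
    rw [map_mul, map_mul, hz, mul_assoc]
    exact congrArg _ hcs
  obtain ⟨r, t, ht, rfl⟩ := IsFractionRing.div_surjective (A := R) b
  have ht0 : algebraMap R F t ≠ 0 := IsFractionRing.to_map_ne_zero_of_mem_nonZeroDivisors ht
  -- In the discrete valuation ring at p one of r, t divides the other. If r divides t, then b = s /
  -- c with s outside p, and s = b c keeps c outside p as well.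
  rcases ValuationRing.dvd_total (algebraMap R (Localization.AtPrime p) t)
    (algebraMap R (Localization.AtPrime p) r) with h | h
  · obtain ⟨c, s, hs, hcs⟩ := hdvd _ _ h
    refine ⟨c, s, (hunit s hs).1, (hunit s hs).2, ?_⟩
    rw [div_eq_div_iff ht0 (hunit s hs).1, ← map_mul, ← map_mul, hcs, mul_comm]
  · obtain ⟨c, s, hs, hcs⟩ := hdvd _ _ h
    have hcs' : algebraMap R F t * algebraMap R F s = algebraMap R F r * algebraMap R F c := by
      rw [← map_mul, ← map_mul, hcs]
    have hc : c ∉ p := by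
      intro hc
      apply hs
      have h1 : j s = ⟨_, hb⟩ * j c := by
        apply Subtype.ext
        change algebraMap R F s = algebraMap R F r / algebraMap R F t * algebraMap R F c
        rw [div_mul_eq_mul_div, ← hcs', mul_div_cancel_left₀ _ ht0]
      have h2 : j c ∈ IsLocalRing.maximalIdeal V := hc
      change j s ∈ IsLocalRing.maximalIdeal V
      rw [h1]
      exact Ideal.mul_mem_left _ _ h2
    refine ⟨s, c, (hunit c hc).1, (hunit c hc).2, ?_⟩
    rw [div_eq_div_iff ht0 (hunit c hc).1, ← hcs', mul_comm]

section Regular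

variable {K F : Type*} [Field K] [Field F] [Algebra K F] {P : Place K F} {ω : Ω[F⁄K]}

/-- A regular differential that generates all differentials of regular functions generates the
regular differentials. -/
theorem smul_mem_regularDifferentialsAt_iff (hω : ω ∈ regularDifferentialsAt K F P) (hω0 : ω ≠ 0)
    {δ : F → F} (hδ : ∀ b, KaehlerDifferential.D K F b = δ b • ω)
    (hst : ∀ b ∈ P.ring, δ b ∈ P.ring) (h : F) :
    h • ω ∈ regularDifferentialsAt K F P ↔ h ∈ P.ring := by
  constructor
  · intro hh
    have key : ∀ η ∈ regularDifferentialsAt K F P, ∃ a ∈ P.ring, η = a • ω := by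
      intro η hη
      induction hη using Submodule.span_induction with
      | mem η hη =>
        obtain ⟨a, ha, b, hb, rfl⟩ := hη
        exact ⟨a * δ b, P.ring.mul_mem _ _ ha (hst b hb), by rw [hδ, smul_smul]⟩
      | zero => exact ⟨0, P.ring.zero_mem, by rw [zero_smul]⟩
      | add η θ _ _ h1 h2 =>
        obtain ⟨a, ha, rfl⟩ := h1
        obtain ⟨b, hb, rfl⟩ := h2
        exact ⟨a + b, P.ring.add_mem _ _ ha hb, by rw [add_smul]⟩
      | smul c η _ h1 =>
        obtain ⟨a, ha, rfl⟩ := h1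
        exact ⟨algebraMap K F c * a, P.ring.mul_mem _ _ (P.algebraMap_mem c) ha,
          by rw [← smul_smul, algebraMap_smul]⟩
    obtain ⟨a, ha, e⟩ := key _ hh
    rwa [smul_left_injective F hω0 e]
  · intro hh
    clear hω0 hδ
    induction hω using Submodule.span_induction with
    | mem η hη =>
      obtain ⟨a, ha, b, hb, rfl⟩ := hη
      exact Submodule.subset_span ⟨h * a, P.ring.mul_mem _ _ hh ha, b, hb, smul_smul _ _ _⟩
    | zero => rw [smul_zero]; exact zero_mem _
    | add η θ _ _ h1 h2 => rw [smul_add]; exact add_mem h1 h2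
    | smul c η _ h1 => rw [smul_comm]; exact Submodule.smul_mem _ c h1

end Regular

namespace QuadraticCover

variable {K : Type*} [Field K] {H : QuadraticCover K}

theorem algebraMap_mem_of_x_mem {P : Place K H.FunctionField} (hx : H.x ∈ P.ring)
    (r : H.CoordinateRing) : algebraMap _ H.FunctionField r ∈ P.ring := by
  obtain ⟨p, q, h⟩ := H.exists_coordinateRing r
  have hy : H.y ∈ P.ring := P.mem_of_sq_mem (by rw [y_sq]; exact P.aeval_mem hx _)
  rw [h]
  exact P.ring.add_mem _ _ (P.aeval_mem hx p) (P.ring.mul_mem _ _ (P.aeval_mem hx q) hy)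

/-- A Dedekind domain is the intersection of its localizations at nonzero primes, and each of these
is the local ring of a place where x is regular. -/
theorem exists_coordinateRing_of_forall_place (h2 : (2 : K) ≠ 0) {h : H.FunctionField}
    (hh : ∀ P : Place K H.FunctionField, H.x ∈ P.ring → h ∈ P.ring) :
    ∃ r : H.CoordinateRing, algebraMap _ _ r = h := by
  have := H.isDedekindDomain h2
  refine IsDedekindDomain.HeightOneSpectrum.mem_integers_of_valuation_le_one H.FunctionField h
    fun v => ?_
  have hR : ∀ r : H.CoordinateRing, algebraMap _ H.FunctionField r
      ∈ (v.valuation H.FunctionField).valuationSubring := fun r => v.valuation_le_one r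
  let P : Place K H.FunctionField :=
    { ring := (v.valuation H.FunctionField).valuationSubring
      algebraMap_mem := fun c => by
        rw [IsScalarTower.algebraMap_apply K H.CoordinateRing H.FunctionField]
        exact hR _
      ne_top := fun htop => by
        obtain ⟨π, hπ⟩ := v.valuation_exists_uniformizer H.FunctionField
        have h1 : π⁻¹ ∈ (v.valuation H.FunctionField).valuationSubring :=
          htop ▸ ValuationSubring.mem_top _
        rw [Valuation.mem_valuationSubring_iff, map_inv₀, hπ] at h1
        revert h1
        rw [← WithZero.exp_neg, neg_neg, ← WithZero.exp_zero, WithZero.exp_le_exp]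
        norm_num }
  exact hh P (hR _)

/-- At a place where `s = σ(x)` is regular, `ds / σ(y)` generates the regular differentials. -/
theorem mem_regularDifferentialsAt_iff (h2 : (2 : K) ≠ 0)
    (σ : H.FunctionField ≃ₐ[K] H.FunctionField) {P : Place K H.FunctionField}
    (hx : σ H.x ∈ P.ring) {δ₀ : Derivation K H.FunctionField H.FunctionField}
    (hδ₀ : ∀ b, KaehlerDifferential.D K _ b = δ₀ b • KaehlerDifferential.D K _ H.x)
    (hσ : δ₀ (σ H.x) ≠ 0) (hDx : KaehlerDifferential.D K _ H.x ≠ 0) (h : H.FunctionField) :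
    h • ((σ H.y)⁻¹ • KaehlerDifferential.D K _ (σ H.x)) ∈ regularDifferentialsAt K _ P
      ↔ h ∈ P.ring := by
  have := H.isDedekindDomain h2
  have hyx : (σ H.y) ^ 2 = aeval (σ H.x) H.f := by
    rw [← map_pow, H.y_sq, ← AlgEquiv.coe_toAlgHom, aeval_algHom_apply]
  have hy : σ H.y ∈ P.ring := P.mem_of_sq_mem (by rw [hyx]; exact P.aeval_mem hx _)
  have hy0 : σ H.y ≠ 0 := by
    rw [Ne, map_eq_zero_iff _ σ.injective]
    intro h0
    have := H.y_sq
    rw [h0, zero_pow two_ne_zero, eq_comm,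
      map_eq_zero_iff _ (aeval_injective H.transcendental_x)] at this
    exact H.separable.ne_zero this
  have h2' : (2 : H.FunctionField) ≠ 0 := by
    simpa [map_ofNat] using (algebraMap K H.FunctionField).injective.ne h2
  set s := σ H.x with hs
  set w := σ H.y with hw
  -- The derivation w d/ds preserves K[s, w], because δ s = w and 2 δ w = f'(s).
  let δ : Derivation K H.FunctionField H.FunctionField := (w / δ₀ s) • δ₀
  have hδs : δ s = w := by
    change w / δ₀ s * δ₀ s = w
    rw [div_mul_cancel₀ _ hσ]
  have hδw : 2 * δ w = aeval s (derivative H.f) := by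
    have e := congrArg δ hyx
    rw [Derivation.map_aeval, hδs, pow_two w, Derivation.leibniz, smul_eq_mul, smul_eq_mul] at e
    apply mul_right_cancel₀ hy0
    linear_combination e
  have hδ : ∀ b, KaehlerDifferential.D K _ b = δ b • (w⁻¹ • KaehlerDifferential.D K _ s) := by
    intro b
    rw [hδ₀ b, hδ₀ s, smul_smul, smul_smul]
    congr 1
    change δ₀ b = w / δ₀ s * δ₀ b * w⁻¹ * δ₀ s
    field_simp
  have h2inv : (2 : H.FunctionField)⁻¹ ∈ P.ring := by
    have := P.algebraMap_mem (2 : K)⁻¹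
    rwa [map_inv₀, map_ofNat] at this
  have hδw_mem : δ w ∈ P.ring := by
    rw [show δ w = 2⁻¹ * aeval s (derivative H.f) by rw [← hδw, inv_mul_cancel_left₀ h2']]
    exact P.ring.mul_mem _ _ h2inv (P.aeval_mem hx _)
  refine smul_mem_regularDifferentialsAt_iff ?_ ?_ hδ ?_ h
  · obtain ⟨u, v, huv⟩ := H.separable
    have e1 : aeval s u * w ^ 2 + aeval s v * (2 * δ w) = 1 := by
      rw [hyx, hδw, ← map_mul, ← map_mul, ← map_add, huv, map_one]
    -- From u f + v f' = 1 follows ds / w = (u w² + 2 v δ w) ds / w = u w ds + 2 v dw, which is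
    -- visibly regular.
    have e2 : w⁻¹ • KaehlerDifferential.D K _ s = (aeval s u * w) • KaehlerDifferential.D K _ s
        + (2 * aeval s v) • KaehlerDifferential.D K _ w := by
      rw [hδ w, smul_smul, smul_smul, ← add_smul]
      congr 1
      field_simp
      linear_combination -e1
    rw [e2]
    have h2m : (2 : H.FunctionField) ∈ P.ring := by
      have := P.algebraMap_mem (2 : K)
      rwa [map_ofNat] at this
    exact add_mem
      (Submodule.subset_span ⟨_, P.ring.mul_mem _ _ (P.aeval_mem hx u) hy, s, hx, rfl⟩)
      (Submodule.subset_span ⟨_, P.ring.mul_mem _ _ h2m (P.aeval_mem hx v), w, hy, rfl⟩)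
  · rw [hδ₀ s, smul_smul]
    exact smul_ne_zero (mul_ne_zero (inv_ne_zero hy0) hσ) hDx
  · intro b hb
    have hpoly : ∀ p : K[X], δ (aeval s p) ∈ P.ring := by
      intro p
      rw [Derivation.map_aeval, hδs]
      exact P.ring.mul_mem _ _ (P.aeval_mem hx _) hy
    have hR : ∀ r : H.CoordinateRing, σ (algebraMap _ H.FunctionField r) ∈ P.ring ∧
        δ (σ (algebraMap _ H.FunctionField r)) ∈ P.ring := by
      intro r
      refine ⟨algebraMap_mem_of_x_mem (P := P.comapEquiv σ) hx r, ?_⟩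
      obtain ⟨p, q, e⟩ := H.exists_coordinateRing r
      have hσp : ∀ p : K[X], σ (aeval H.x p) = aeval s p := fun p => by
        rw [← AlgEquiv.coe_toAlgHom, ← aeval_algHom_apply]; rfl
      rw [e, map_add, map_mul, hσp, hσp, ← hw, map_add, Derivation.leibniz, smul_eq_mul,
        smul_eq_mul]
      exact P.ring.add_mem _ _ (hpoly p) (P.ring.add_mem _ _
        (P.ring.mul_mem _ _ (P.aeval_mem hx q) hδw_mem) (P.ring.mul_mem _ _ hy (hpoly q)))
    -- Every element of the local ring at P is a fraction of elements of σ(K[x, y]) whose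
    -- denominator is a unit at P, so the quotient rule extends the stability under δ to it.
    have hb' : σ.symm b ∈ (P.comapEquiv σ).ring := by
      rw [Place.mem_comapEquiv, AlgEquiv.apply_symm_apply]
      exact hb
    obtain ⟨r, t, ht0, ht, e⟩ := (P.comapEquiv σ).ring.exists_eq_div_of_isDedekindDomain
      (P.comapEquiv σ).ne_top (algebraMap_mem_of_x_mem (P := P.comapEquiv σ) hx) hb'
    rw [Place.mem_comapEquiv, map_inv₀] at ht
    have e' : b = σ (algebraMap _ _ r) / σ (algebraMap _ _ t) := by
      rw [← map_div₀, ← e, AlgEquiv.apply_symm_apply]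
    have ht0' : σ (algebraMap _ _ t) ≠ 0 := by rwa [Ne, map_eq_zero_iff _ σ.injective]
    have e3 : δ b = (δ (σ (algebraMap _ _ r)) - b * δ (σ (algebraMap _ _ t)))
        * (σ (algebraMap _ _ t))⁻¹ := by
      have e4 : σ (algebraMap _ _ r) = b * σ (algebraMap _ _ t) := by
        rw [e', div_mul_cancel₀ _ ht0']
      rw [e4, Derivation.leibniz, smul_eq_mul, smul_eq_mul]
      field_simp
      ring
    rw [e3]
    exact P.ring.mul_mem _ _ (P.ring.sub_mem (hR r).2 (P.ring.mul_mem _ _ hb (hR t).2)) ht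

end QuadraticCover

/-! ### The genus of `y² = f(x)` for the reciprocal polynomial of degree `12` -/

theorem Polynomial.aeval_inv_mul_pow {K L : Type*} [Field K] [Field L] [Algebra K L] {x : L}
    (hx : x ≠ 0) (p : K[X]) : aeval x⁻¹ p * x ^ p.natDegree = aeval x p.reverse := by
  let _ : Invertible x⁻¹ := invertibleOfNonzero (inv_ne_zero hx)
  have h := eval₂_reverse_mul_pow (algebraMap K L) x⁻¹ p
  rw [invOf_eq_inv, inv_inv] at h
  rw [aeval_def, aeval_def, ← h, mul_assoc, ← mul_pow, inv_mul_cancel₀ hx, one_pow, mul_one]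

/-- The constant coefficient of the reverse is the leading coefficient, so X does not divide the
reverse of a nonzero polynomial. -/
theorem Polynomial.eq_zero_of_X_pow_mul_reverse {K : Type*} [Field K] {p q : K[X]} {m n : ℕ}
    (hmn : m < n) (h : X ^ m * p.reverse = X ^ n * q) : p = 0 := by
  have h1 : p.reverse = X ^ (n - m) * q := by
    apply mul_left_cancel₀ (pow_ne_zero m (X_ne_zero (R := K)))
    rw [h, ← mul_assoc, ← pow_add, Nat.add_sub_cancel' hmn.le]
  have h2 := congrArg (fun r => coeff r 0) h1
  simp only [coeff_zero_reverse, mul_coeff_zero, coeff_X_pow] at h2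
  rw [if_neg (by omega), zero_mul, leadingCoeff_eq_zero] at h2
  exact h2

namespace QuadraticCover

variable {K : Type*} [Field K] {H : QuadraticCover K} {A : K}

/-- The automorphism `(x, y) ↦ (1 / x, y / x⁶)`. -/
theorem exists_reciprocal (hH : H.f = hyperellipticPoly A) :
    ∃ σ : H.FunctionField ≃ₐ[K] H.FunctionField, σ H.x = H.x⁻¹ ∧ σ H.y = H.y * H.x⁻¹ ^ 6 := by
  have hx0 := H.x_ne_zero
  have ht : Transcendental K H.x⁻¹ := fun h => H.transcendental_x (by simpa using h.inv)
  have hw : (H.y * H.x⁻¹ ^ 6) ^ 2 = aeval H.x⁻¹ H.f := by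
    have e := H.y_sq.trans (congrArg (aeval H.x) hH)
    refine Eq.trans ?_ (congrArg (aeval H.x⁻¹) hH).symm
    rw [mul_pow, e, aeval_hyperellipticPoly, aeval_hyperellipticPoly]
    field_simp
    ring
  have hx' : H.lift ht hw H.x = H.x⁻¹ := lift_x ..
  have hy' : H.lift ht hw H.y = H.y * H.x⁻¹ ^ 6 := lift_y ..
  have hcomp : (H.lift ht hw).comp (H.lift ht hw) = AlgHom.id K H.FunctionField := by
    apply H.algHom_ext
    · rw [AlgHom.comp_apply, hx', map_inv₀, hx', inv_inv]; rfl
    · rw [AlgHom.comp_apply, hy', map_mul, map_pow, map_inv₀, hx', hy', inv_inv, mul_assoc,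
        ← mul_pow, inv_mul_cancel₀ hx0, one_pow, mul_one]
      rfl
  exact ⟨AlgEquiv.ofAlgHom _ _ hcomp hcomp, hx', hy'⟩

/-- The left side is the image under (x, y) ↦ (1 / x, y / x⁶) of (a + b y) x⁻⁴; the right side says
that it has no pole where x is regular. Clearing denominators with reversed polynomials and
comparing orders at X = 0 kills b and bounds the degree of a by 4. -/
theorem degree_lt_of_reciprocal {a b c d : K[X]}
    (h : (aeval H.x⁻¹ a + aeval H.x⁻¹ b * (H.y * H.x⁻¹ ^ 6)) * H.x ^ 4
      = aeval H.x c + aeval H.x d * H.y) : b = 0 ∧ a ∈ degreeLT K 5 := by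
  have hx0 := H.x_ne_zero
  have ha := aeval_inv_mul_pow hx0 a
  have hb := aeval_inv_mul_pow hx0 b
  have key : aeval H.x (X ^ (b.natDegree + 6) * a.reverse
        - X ^ (a.natDegree + b.natDegree + 2) * c)
      + aeval H.x (X ^ a.natDegree * b.reverse
        - X ^ (a.natDegree + b.natDegree + 2) * d) * H.y = 0 := by
    simp only [map_sub, map_mul, map_pow, aeval_X, ← ha, ← hb]
    have e : H.x⁻¹ ^ 6 * H.x ^ 6 = 1 := by rw [← mul_pow, inv_mul_cancel₀ hx0, one_pow]
    linear_combination H.x ^ (a.natDegree + b.natDegree + 2) * h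
      - aeval H.x⁻¹ b * H.y * H.x ^ (a.natDegree + b.natDegree) * e
  obtain ⟨k1, k2⟩ := H.eq_zero_of_add_mul_eq_zero H.transcendental_x H.y_sq key
  refine ⟨eq_zero_of_X_pow_mul_reverse (by omega) (sub_eq_zero.mp k2), ?_⟩
  rw [mem_degreeLT]
  by_cases hn : a.natDegree ≤ 4
  · exact (degree_le_natDegree).trans_lt (by exact_mod_cast Nat.lt_succ_of_le hn)
  · have := eq_zero_of_X_pow_mul_reverse (by omega) (sub_eq_zero.mp k1)
    rw [this, degree_zero]
    exact WithBot.bot_lt_coe _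

/-- A differential h dx / y is regular where x is exactly when h is, and regular where 1 / x is
exactly when h x⁻⁴ is. Together these leave the polynomials h in x of degree at most 4. -/
theorem genus_eq_five (h2 : (2 : K) ≠ 0) (hH : H.f = hyperellipticPoly A) :
    curveGenus K H.FunctionField = 5 := by
  obtain ⟨e, he⟩ := H.exists_kaehlerDifferential_equiv h2
  obtain ⟨σ, hσx, hσy⟩ := exists_reciprocal hH
  have hx0 := H.x_ne_zero
  have hy0 : H.y ≠ 0 := by
    intro h0
    have := H.y_sq
    rw [h0, zero_pow two_ne_zero, eq_comm,
      map_eq_zero_iff _ (aeval_injective H.transcendental_x)] at this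
    exact H.separable.ne_zero this
  let δ₀ : Derivation K H.FunctionField H.FunctionField :=
    (e : (Ω[H.FunctionField⁄K]) →ₗ[H.FunctionField] H.FunctionField).compDer
      (KaehlerDifferential.D K _)
  have hsmul : ∀ η : Ω[H.FunctionField⁄K], η = e η • KaehlerDifferential.D K _ H.x := by
    intro η
    apply e.injective
    rw [map_smul, he, smul_eq_mul, mul_one]
  have hδ₀ : ∀ b, KaehlerDifferential.D K _ b = δ₀ b • KaehlerDifferential.D K _ H.x :=
    fun b => hsmul _
  have hδx : δ₀ H.x = 1 := he
  have hDx : KaehlerDifferential.D K _ H.x ≠ 0 := by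
    intro h0
    rw [h0, map_zero] at he
    exact zero_ne_one he
  have hδσ : δ₀ (σ H.x) = -(H.x⁻¹ ^ 2) := by
    have h1 := congrArg δ₀ (mul_inv_cancel₀ hx0)
    rw [Derivation.leibniz, smul_eq_mul, smul_eq_mul, hδx, Derivation.map_one_eq_zero] at h1
    rw [hσx]
    apply mul_left_cancel₀ hx0
    have h3 := mul_inv_cancel₀ hx0
    linear_combination h1 + H.x⁻¹ * h3
  have hδσ0 : δ₀ (σ H.x) ≠ 0 := by
    rw [hδσ]
    exact neg_ne_zero.mpr (pow_ne_zero 2 (inv_ne_zero hx0))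
  -- Since d(1 / x) = -dx / x² and σ y = y / x⁶, the generator changes by the factor -x⁴.
  have hσω : (σ H.y)⁻¹ • KaehlerDifferential.D K _ (σ H.x)
      = -(H.x ^ 4) • (H.y⁻¹ • KaehlerDifferential.D K _ H.x) := by
    rw [hδ₀ (σ H.x), hδσ, hσy, smul_smul, smul_smul]
    congr 1
    field_simp
  set ω := H.y⁻¹ • KaehlerDifferential.D K _ H.x with hω
  have hω0 : ω ≠ 0 := smul_ne_zero (inv_ne_zero hy0) hDx
  have hfin : ∀ P : Place K H.FunctionField, H.x ∈ P.ring → ∀ h,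
      h • ω ∈ regularDifferentialsAt K _ P ↔ h ∈ P.ring := fun P hP h =>
    mem_regularDifferentialsAt_iff h2 AlgEquiv.refl hP hδ₀ (by simp [hδx]) hDx h
  have hinf : ∀ P : Place K H.FunctionField, H.x⁻¹ ∈ P.ring → ∀ h,
      h • ω ∈ regularDifferentialsAt K _ P ↔ h * H.x⁻¹ ^ 4 ∈ P.ring := by
    intro P hP h
    have h1 := mem_regularDifferentialsAt_iff h2 σ (P := P) (by rwa [hσx]) hδ₀ hδσ0 hDx
      (-(h * H.x⁻¹ ^ 4))
    rw [hσω, smul_smul, neg_mul_neg, mul_assoc, ← mul_pow, inv_mul_cancel₀ hx0, one_pow, mul_one,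
      neg_mem_iff] at h1
    exact h1
  let Λ : K[X] →ₗ[K] Ω[H.FunctionField⁄K] :=
    ((LinearMap.toSpanSingleton H.FunctionField _ ω).restrictScalars K).comp
      (aeval H.x : K[X] →ₐ[K] H.FunctionField).toLinearMap
  have hΛ : ∀ p, Λ p = aeval H.x p • ω := fun p => rfl
  have hΛinj : Function.Injective Λ := by
    intro p q hpq
    rw [hΛ, hΛ] at hpq
    exact aeval_injective H.transcendental_x (smul_left_injective _ hω0 hpq)
  have hmap : (⨅ P : Place K H.FunctionField, regularDifferentialsAt K H.FunctionField P)
      = (degreeLT K 5).map Λ := by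
    apply le_antisymm
    · intro η hη
      rw [Submodule.mem_iInf] at hη
      obtain ⟨h, rfl⟩ : ∃ h : H.FunctionField, η = h • ω := ⟨e η * H.y, by
        rw [hω, smul_smul, mul_inv_cancel_right₀ hy0]; exact hsmul η⟩
      obtain ⟨r, hr⟩ := exists_coordinateRing_of_forall_place h2
        fun P hP => (hfin P hP h).mp (hη P)
      obtain ⟨a, b, hab⟩ := H.exists_coordinateRing r
      -- σ exchanges regularity of x and of 1 / x, which turns the condition on h x⁻⁴ into
      -- membership of σ(h x⁻⁴) in the coordinate ring.
      have hσσ : ∀ P : Place K H.FunctionField, H.x ∈ P.ring → σ (h * H.x⁻¹ ^ 4) ∈ P.ring := by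
        intro P hP
        have h1 : H.x⁻¹ ∈ (P.comapEquiv σ).ring := by
          rw [Place.mem_comapEquiv, map_inv₀, hσx, inv_inv]
          exact hP
        exact (hinf _ h1 h).mp (hη _)
      obtain ⟨r', hr'⟩ := exists_coordinateRing_of_forall_place h2 hσσ
      obtain ⟨c, d, hcd⟩ := H.exists_coordinateRing r'
      have hσp : ∀ p : K[X], σ (aeval H.x p) = aeval H.x⁻¹ p := fun p => by
        rw [← AlgEquiv.coe_toAlgHom, ← aeval_algHom_apply, AlgEquiv.coe_toAlgHom, hσx]
      have hrec : σ (h * H.x⁻¹ ^ 4) = aeval H.x c + aeval H.x d * H.y := by rw [← hcd, hr']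
      rw [← hr, hab, map_mul, map_add, map_mul, hσp, hσp, hσy, map_pow, map_inv₀, hσx,
        inv_inv] at hrec
      obtain ⟨rfl, ha⟩ := degree_lt_of_reciprocal hrec
      refine ⟨a, ha, ?_⟩
      rw [hΛ, ← hr, hab, map_zero, zero_mul, add_zero]
    · rintro _ ⟨a, ha, rfl⟩
      rw [Submodule.mem_iInf]
      intro P
      rw [hΛ]
      rcases P.ring.mem_or_inv_mem H.x with hP | hP
      · exact (hfin P hP _).mpr (P.aeval_mem hP a)
      · rw [hinf P hP]
        have hdeg : a.natDegree ≤ 4 := by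
          rw [SetLike.mem_coe, mem_degreeLT] at ha
          by_cases ha0 : a = 0
          · simp [ha0]
          · rw [degree_eq_natDegree ha0] at ha
            exact Nat.lt_succ_iff.mp (by exact_mod_cast ha)
        have h1 := aeval_inv_mul_pow (inv_ne_zero hx0) a
        rw [inv_inv] at h1
        rw [show H.x⁻¹ ^ 4 = H.x⁻¹ ^ a.natDegree * H.x⁻¹ ^ (4 - a.natDegree) by
          rw [← pow_add, Nat.add_sub_cancel' hdeg], ← mul_assoc, h1]
        exact P.ring.mul_mem _ _ (P.aeval_mem hP _) (pow_mem hP _)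
  rw [curveGenus, hmap, ← (Submodule.equivMapOfInjective Λ hΛinj (degreeLT K 5)).finrank_eq,
    (degreeLTEquiv K 5).finrank_eq, Module.finrank_fin_fun]

end QuadraticCover

/-! ### The j-invariant of E and the assembly of the theorem -/

theorem hyperellipticPoly_natDegree_pos {K : Type*} [Field K] {A : K} (hA : A ≠ 0) :
    0 < (hyperellipticPoly A).natDegree := by
  have h : (hyperellipticPoly A).natDegree = 12 := by
    unfold hyperellipticPoly
    compute_degree!
  omega

namespace WeierstrassCurve

variable {K : Type*} [Field K] {A j : K} {E : WeierstrassCurve K}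

/-- Here c₄ = 48A and Δ = 16A² (4A - 27), so the invariant is 6912A / (4A - 27); `hA` is this
relation solved for A. -/
theorem isElliptic_and_j_eq (h2 : (2 : K) ≠ 0) (hA0 : A ≠ 0) (hA27 : 4 * A ≠ 27)
    (hA : 4 * A * (j - 1728) = 27 * j) (hE : E = ⟨0, 0, 0, -A, A⟩) :
    ∃ _ : E.IsElliptic, E.j = j := by
  have hΔ : E.Δ = 16 * A ^ 2 * (4 * A - 27) := by
    subst hE
    simp only [WeierstrassCurve.Δ, WeierstrassCurve.b₂, WeierstrassCurve.b₄, WeierstrassCurve.b₆,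
      WeierstrassCurve.b₈]
    ring
  have hΔ0 : E.Δ ≠ 0 := by
    rw [hΔ, show (16 : K) = 2 ^ 4 by norm_num]
    exact mul_ne_zero (mul_ne_zero (pow_ne_zero 4 h2) (pow_ne_zero 2 hA0)) (sub_ne_zero.mpr hA27)
  refine ⟨⟨IsUnit.mk0 _ hΔ0⟩, ?_⟩
  have : E.IsElliptic := ⟨IsUnit.mk0 _ hΔ0⟩
  rw [WeierstrassCurve.j, Units.val_inv_eq_inv_val, WeierstrassCurve.coe_Δ', inv_mul_eq_div,
    div_eq_iff hΔ0, hΔ]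
  subst hE
  simp only [WeierstrassCurve.c₄, WeierstrassCurve.b₂, WeierstrassCurve.b₄]
  linear_combination -1 * (16 * A ^ 2) * hA

end WeierstrassCurve

theorem exists_independentMaps {K : Type*} [Field K] {A : K} {E : WeierstrassCurve K}
    {H D : QuadraticCover K} (h2 : (2 : K) ≠ 0) (hA0 : A ≠ 0) (hA27 : 4 * A ≠ 27)
    (hH : H.f = hyperellipticPoly A) (hD : D.f = X ^ 4 + X ^ 3 + C (A / 2 ^ 6))
    (hE : E = ⟨0, 0, 0, -A, A⟩) :
    ∃ ι : SpaceCurveRing (A / 2 ^ 6) →ₐ[K] H.FunctionField, IsFunctionFieldEmbedding ι ∧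
      ∃ f₁ f₂ : CurveMap K H.FunctionField D.FunctionField,
        (f₁.pullback D.x = ι (spaceCurveCoord (A / 2 ^ 6) 0) ∧
          f₁.pullback D.y = ι (spaceCurveCoord (A / 2 ^ 6) 1)) ∧
        (f₂.pullback D.x = ι (spaceCurveCoord (A / 2 ^ 6) 2) ∧
          f₂.pullback D.y = ι (spaceCurveCoord (A / 2 ^ 6) 1)) ∧
        ∃ ψ : CurveMap K D.FunctionField E.toAffine.FunctionField, ψ.IsIso ∧
          IndependentMaps E.toAffine (ψ.comp f₁) (ψ.comp f₂) := by
  have hDX : H.spaceY ^ 2 = aeval H.spaceX D.f := by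
    rw [QuadraticCover.spaceY_sq h2 hH, hD]; simp
  have hDZ : H.spaceY ^ 2 = aeval H.spaceZ D.f := by
    rw [QuadraticCover.spaceZ_sq h2 hH, hD]; simp
  let φ₁ := D.lift H.transcendental_spaceX hDX
  let φ₂ := D.lift (QuadraticCover.transcendental_spaceZ h2 hH) hDZ
  have hφ₁ : Algebra.IsAlgebraic φ₁.fieldRange H.FunctionField :=
    QuadraticCover.isAlgebraic_of_spaceX_mem h2 _ ⟨D.x, D.lift_x _ _⟩ ⟨D.y, D.lift_y _ _⟩
  have hφ₂ : Algebra.IsAlgebraic φ₂.fieldRange H.FunctionField :=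
    QuadraticCover.isAlgebraic_of_spaceZ_mem h2 _ ⟨D.x, D.lift_x _ _⟩ ⟨D.y, D.lift_y _ _⟩
  obtain ⟨ψ, hψ⟩ := exists_curveMap_isIso hE D hD h2
  have h0 := H.spaceCurveMap_coord h2 hH 0
  have h1 := H.spaceCurveMap_coord h2 hH 1
  have h2' := H.spaceCurveMap_coord h2 hH 2
  have x1 : φ₁ D.x = H.spaceX := D.lift_x _ _
  have y1 : φ₁ D.y = H.spaceY := D.lift_y _ _
  have x2 : φ₂ D.x = H.spaceZ := D.lift_x _ _
  have y2 : φ₂ D.y = H.spaceY := D.lift_y _ _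
  exact ⟨H.spaceCurveMap h2 hH,
    H.spaceCurveMap_isFunctionFieldEmbedding h2 hH,
    CurveMap.ofAlgHom φ₁ hφ₁, CurveMap.ofAlgHom φ₂ hφ₂,
    ⟨x1.trans h0.symm, y1.trans h1.symm⟩, ⟨x2.trans h2'.symm, y2.trans h1.symm⟩, ψ, hψ,
    independentMaps h2 hA0 hA27 hH hD hE x1 y1 x2 y2 ψ⟩

theorem theorem2 {K : Type*} [Field K] (h2 : ringChar K ≠ 2) (h3 : ringChar K ≠ 3)
    (j : K) (hj0 : j ≠ 0) (hj1728 : j ≠ 1728)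
    (A : K) (hA : A = 3 ^ 3 * j / (2 ^ 2 * (j - 1728)))
    (E : WeierstrassCurve K) (hE : E = ⟨0, 0, 0, -A, A⟩) :
    -- `E : y² = x³ - A x + A` is an elliptic curve with `j`-invariant `j`
    (∃ _ : E.IsElliptic, E.j = j) ∧
    -- the hyperelliptic curve `H` and the curve `D : y² = x⁴ + x³ + A / 2⁶`
    ∃ H D : QuadraticCover K,
      H.f = C A * (X + 1) ^ 4 * (X ^ 2 + 1) ^ 4 - 2 ^ 6 * X ^ 3 * (X ^ 2 + X + 1) ^ 3 ∧
      curveGenus K H.FunctionField = 5 ∧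
      D.f = X ^ 4 + X ^ 3 + C (A / 2 ^ 6) ∧
      -- `H` is the desingularized projective closure of the space curve
      ∃ ι : SpaceCurveRing (A / 2 ^ 6) →ₐ[K] H.FunctionField, IsFunctionFieldEmbedding ι ∧
      -- the maps `(x, y, z) ↦ (x, y)` and `(x, y, z) ↦ (z, y)` from `H` to `D`
      ∃ f₁ f₂ : CurveMap K H.FunctionField D.FunctionField,
        (f₁.pullback D.x = ι (spaceCurveCoord (A / 2 ^ 6) 0) ∧
          f₁.pullback D.y = ι (spaceCurveCoord (A / 2 ^ 6) 1)) ∧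
        (f₂.pullback D.x = ι (spaceCurveCoord (A / 2 ^ 6) 2) ∧
          f₂.pullback D.y = ι (spaceCurveCoord (A / 2 ^ 6) 1)) ∧
        -- an isomorphism from `D` to `E`, through which they give independent maps from `H` to `E`
        ∃ ψ : CurveMap K D.FunctionField E.toAffine.FunctionField, ψ.IsIso ∧
          IndependentMaps E.toAffine (ψ.comp f₁) (ψ.comp f₂) := by
  obtain ⟨h2, h3⟩ := two_three_ne_zero h2 h3
  have hj : j - 1728 ≠ 0 := sub_ne_zero.mpr hj1728
  have hA0 : A ≠ 0 := by
    rw [hA]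
    exact div_ne_zero (mul_ne_zero (pow_ne_zero 3 h3) hj0) (mul_ne_zero (pow_ne_zero 2 h2) hj)
  have h1728 : (1728 : K) ≠ 0 := by
    rw [show (1728 : K) = 2 ^ 6 * 3 ^ 3 by norm_num]
    exact mul_ne_zero (pow_ne_zero 6 h2) (pow_ne_zero 3 h3)
  have hA4 : 4 * A * (j - 1728) = 27 * j := by
    rw [hA]; field_simp; ring
  -- Otherwise 27 (j - 1728) = 27 j, so that 27 · 1728 = 2⁶ · 3⁶ would vanish in K.
  have hA27 : 4 * A ≠ 27 := by
    intro h
    have : (27 : K) * 1728 = 0 := by linear_combination (j - 1728) * h - hA4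
    rw [show (27 : K) = 3 ^ 3 by norm_num] at this
    exact mul_ne_zero (pow_ne_zero 3 h3) h1728 this
  have h26 : (2 : K) ^ 6 ≠ 0 := pow_ne_zero 6 h2
  obtain ⟨H, hH⟩ : ∃ H : QuadraticCover K, H.f = hyperellipticPoly A :=
    ⟨⟨_, separable_hyperellipticPoly h2 hA0 hA27, hyperellipticPoly_natDegree_pos hA0⟩, rfl⟩
  obtain ⟨D, hD⟩ : ∃ D : QuadraticCover K, D.f = X ^ 4 + X ^ 3 + C (A / 2 ^ 6) :=
    ⟨⟨_, separable_quartic (div_ne_zero hA0 h26) (fun h => hA27 (by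
      rw [← h, show (256 : K) = 4 * 2 ^ 6 by norm_num]; field_simp)), by
      rw [show (X ^ 4 + X ^ 3 + C (A / 2 ^ 6) : K[X]).natDegree = 4 by compute_degree!]
      norm_num⟩, rfl⟩
  exact ⟨WeierstrassCurve.isElliptic_and_j_eq h2 hA0 hA27 hA4 hE, H, D, hH,
    QuadraticCover.genus_eq_five h2 hH, hD, exists_independentMaps h2 hA0 hA27 hH hD hE⟩
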